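/- Conventions. A $*$-category is a $\mathbb C$-linear category with a $\mathbb C$-antilinear, involutive, identity-on-objects contravariant endofunctor $f\mapsto f^*$; a morphism $u$ is unitary if $u^*u=\mathrm{id}$ and $uu^*=\mathrm{id}$. A $*$-functor is a linear functor with $F(f^*)=F(f)^*$, and a $*$-equivalence is a $*$-functor $F$ admitting a $*$-functor $G$ such that $GF$ and $FG$ are unitarily naturally isomorphic to the identity functors. A $\mathrm C^*$-category is a $*$-category such that for every $f:a\to b$ there is $g:a\to a$ with $f^*f=g^*g$, and such that $\|f\|=\sup\{|\lambda|^{1/2} : \lambda\in\mathbb C,\ f^*f-\lambda\,\mathrm{id}\text{ is not invertible}\}$ is a complete norm on all morphism spaces with $\|fg\|\le\|f\|\,\|g\|$ and $\|f^*f\|=\|f\|^2$. An object $x$ is simple if $\mathrm{End}(x)\cong\mathbb C$; a $\mathrm C^*$-category is semisimple if it has finite direct sums and every object is a finite direct sum of simple objects. A unitary fusion category is a semisimple $\mathrm C^*$-category with finitely many isomorphism classes of simple objects, equipped with a rigid linear monoidal structure with simple unit, unitary coherence isomorphisms, and $(f\otimes g)^*=f^*\otimes g^*$. A unitary module category over a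 unitary fusion category $\mathcal C$ is a (left) $\mathcal C$-module category $\mathcal M$ which is a semisimple $\mathrm C^*$-category with finitely many isomorphism classes of simple objects, whose action $\vartriangleright:\mathcal C\times\mathcal M\to\mathcal M$ is a (bilinear) $*$-functor, and whose associator $(c\otimes c')\vartriangleright m\cong c\vartriangleright(c'\vartriangleright m)$ is unitary (it is then automatic that $I_{\mathcal C}\vartriangleright -$ is a $*$-equivalence). A module functor $(F,f):\mathcal M\to\mathcal N$ is a functor $F$ with a natural isomorphism $f_{c,m}:F(c\vartriangleright m)\to c\vartriangleright F(m)$ compatible with the associators and unit isomorphisms; it is a module equivalence if $F$ is an equivalence of categories, and a unitary module equivalence if moreover $F$ is a $*$-equivalence and every $f_{c,m}$ is unitary. A natural isomorphism of module functors $(F,f)\Rightarrow(G,g)$ is a natural isomorphism $\eta:F\Rightarrow G$ with $g_{c,m}\,\eta_{c\vartriangleright m}=(c\vartriangleright\eta_m)\,f_{c,m}$ for all $c,m$. Theorem D. Let $\mathcal C$ be a unitary fusion category and let $\mathcal M,\mathcal N$ be unitary module categories over $\mathcal C$. Then every module equivalence $\mathcal M\to\mathcal N$ is naturally isomorphic,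 as a module functor, to a unitary module equivalence. -/

import Mathlib

open CategoryTheory CategoryTheory.Limits CategoryTheory.MonoidalCategory
open scoped CategoryTheory.MonoidalCategory.MonoidalLeftAction
open CategoryTheory.Functor.OplaxLeftLinear (δₗ)

universe v v' v₁ v₂ v₃ u u' u₁ u₂ u₃

namespace UnitaryModule

/-! ### `*`-categories -/

/-- A `*`-structure on a `ℂ`-linear category: a `ℂ`-antilinear, involutive, identity-on-objects
contravariant functor. -/
class StarCategory (C : Type u) [Category.{v} C] [Preadditive C] [Linear ℂ C] where
  /-- The adjoint `f^*` of a morphism `f`. -/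
  dag {X Y : C} (f : X ⟶ Y) : Y ⟶ X
  dag_id (X : C) : dag (𝟙 X) = 𝟙 X
  dag_comp {X Y Z : C} (f : X ⟶ Y) (g : Y ⟶ Z) : dag (f ≫ g) = dag g ≫ dag f
  dag_dag {X Y : C} (f : X ⟶ Y) : dag (dag f) = f
  dag_add {X Y : C} (f g : X ⟶ Y) : dag (f + g) = dag f + dag g
  dag_smul {X Y : C} (z : ℂ) (f : X ⟶ Y) : dag (z • f) = (starRingEnd ℂ z) • dag f

open StarCategory (dag)

section StarCategory

variable {C : Type u} [Category.{v} C] [Preadditive C] [Linear ℂ C] [StarCategory C]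
variable {D : Type u'} [Category.{v'} D] [Preadditive D] [Linear ℂ D] [StarCategory D]

/-- A morphism `w` of a `*`-category is unitary if `w^* w = 1` and `w w^* = 1`. -/
def IsUnitary {X Y : C} (w : X ⟶ Y) : Prop :=
  w ≫ dag w = 𝟙 X ∧ dag w ≫ w = 𝟙 Y

/-- A `*`-functor: a `ℂ`-linear functor with `F(f^*) = F(f)^*`. -/
structure IsStarFunctor (F : C ⥤ D) : Prop where
  map_add {X Y : C} (f g : X ⟶ Y) : F.map (f + g) = F.map f + F.map g
  map_smul {X Y : C} (z : ℂ) (f : X ⟶ Y) : F.map (z • f) = z • F.map f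
  map_dag {X Y : C} (f : X ⟶ Y) : F.map (dag f) = dag (F.map f)

/-- A `*`-equivalence: a `*`-functor which has an inverse `*`-functor up to unitary natural
isomorphisms. -/
structure IsStarEquivalence (F : C ⥤ D) : Prop where
  isStarFunctor : IsStarFunctor F
  exists_inverse : ∃ G : D ⥤ C, IsStarFunctor G ∧
    (∃ η : F ⋙ G ≅ 𝟭 C, ∀ X : C, IsUnitary (η.hom.app X)) ∧
    (∃ ε : G ⋙ F ≅ 𝟭 D, ∀ Y : D, IsUnitary (ε.hom.app Y))

/-! ### (Semisimple) C*-categories -/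

/-- The moduli of the complex numbers `z` for which `f^* f - z` is not invertible. -/
def spectralModuli {X Y : C} (f : X ⟶ Y) : Set ℝ :=
  (fun z : ℂ => ‖z‖) '' spectrum ℂ (End.of (f ≫ dag f))

/-- The C*-norm of a morphism: the square root of the spectral radius of `f^* f`. -/
noncomputable def cstarNorm {X Y : C} (f : X ⟶ Y) : ℝ :=
  Real.sqrt (sSup (spectralModuli f))

/-- An object is simple if its endomorphism algebra is `ℂ`. -/
def IsSimpleObject (X : C) : Prop := Nonempty (End X ≃ₐ[ℂ] ℂ)

end StarCategory

/-- C*-categories: `f^* f` is always of the form `g^* g` with `g` an endomorphism, and the spectral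
radius expression `cstarNorm` is a (finite) complete submultiplicative norm on the morphism spaces
which satisfies the C*-identity. -/
class CStarCategory (C : Type u) [Category.{v} C] [Preadditive C] [Linear ℂ C]
    [StarCategory C] : Prop where
  exists_endo {X Y : C} (f : X ⟶ Y) : ∃ g : X ⟶ X, f ≫ dag f = g ≫ dag g
  bddAbove {X Y : C} (f : X ⟶ Y) : BddAbove (spectralModuli f)
  norm_add_le {X Y : C} (f g : X ⟶ Y) : cstarNorm (f + g) ≤ cstarNorm f + cstarNorm g
  norm_smul {X Y : C} (z : ℂ) (f : X ⟶ Y) : cstarNorm (z • f) = ‖z‖ * cstarNorm f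
  eq_zero_of_norm {X Y : C} (f : X ⟶ Y) : cstarNorm f = 0 → f = 0
  complete {X Y : C} (s : ℕ → (X ⟶ Y)) :
    (∀ ε : ℝ, 0 < ε → ∃ k : ℕ, ∀ m ≥ k, ∀ n ≥ k, cstarNorm (s m - s n) < ε) →
      ∃ f : X ⟶ Y, ∀ ε : ℝ, 0 < ε → ∃ k : ℕ, ∀ n ≥ k, cstarNorm (s n - f) < ε
  norm_comp_le {X Y Z : C} (f : X ⟶ Y) (g : Y ⟶ Z) :
    cstarNorm (f ≫ g) ≤ cstarNorm f * cstarNorm g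
  norm_comp_dag {X Y : C} (f : X ⟶ Y) : cstarNorm (f ≫ dag f) = cstarNorm f ^ 2

/-- Semisimple C*-categories with finitely many (isomorphism classes of) simple objects: there are
finite direct sums (including the empty one), every object is a finite direct sum of simple objects,
and there are finitely many simple objects up to isomorphism. -/
class FinSemisimpleCStarCategory (C : Type u) [Category.{v} C] [Preadditive C] [Linear ℂ C]
    [StarCategory C] : Prop extends CStarCategory C, HasFiniteBiproducts C where
  exists_decomposition (X : C) : ∃ (n : ℕ) (s : Fin n → C),
    (∀ i, IsSimpleObject (s i)) ∧ Nonempty (X ≅ ⨁ s)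
  exists_finite_simples : ∃ (n : ℕ) (s : Fin n → C),
    ∀ X : C, IsSimpleObject X → ∃ i, Nonempty (X ≅ s i)

/-! ### Unitary fusion categories -/

/-- `*`-monoidal categories: linear monoidal categories with a `*`-structure such that
`(f ⊗ g)^* = f^* ⊗ g^*` and all coherence isomorphisms are unitary. -/
class StarMonoidalCategory (C : Type u) [Category.{v} C] [Preadditive C] [Linear ℂ C]
    [StarCategory C] [MonoidalCategory C] : Prop extends
    MonoidalPreadditive C, MonoidalLinear ℂ C where
  dag_tensorHom {W X Y Z : C} (f : W ⟶ X) (g : Y ⟶ Z) : dag (f ⊗ₘ g) = dag f ⊗ₘ dag g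
  associator_unitary (X Y Z : C) : IsUnitary (α_ X Y Z).hom
  leftUnitor_unitary (X : C) : IsUnitary (λ_ X).hom
  rightUnitor_unitary (X : C) : IsUnitary (ρ_ X).hom

/-- Unitary fusion categories: rigid semisimple C*-tensor categories with finitely many simple
objects and simple monoidal unit. -/
class UnitaryFusionCategory (C : Type u) [Category.{v} C] [Preadditive C] [Linear ℂ C]
    [StarCategory C] [MonoidalCategory C] : Prop extends
    FinSemisimpleCStarCategory C, StarMonoidalCategory C where
  exists_rightDual (X : C) : Nonempty (HasRightDual X)
  exists_leftDual (X : C) : Nonempty (HasLeftDual X)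
  unit_simple : IsSimpleObject (𝟙_ C)

/-! ### Unitary module categories -/

/-- Unitary module categories over `C`: module categories (left actions of the monoidal category
`C`) on a semisimple C*-category with finitely many simple objects, such that the action
`C × M → M` is a (bilinear) `*`-functor and the module associator is unitary.

The module unitor `λₗ` is determined by the associator, and it is then automatically unitary, so
that `𝟙_ C ⊙ₗ -` is automatically a `*`-equivalence. -/
class UnitaryModuleCategory (C : Type u) [Category.{v} C] [Preadditive C] [Linear ℂ C]
    [StarCategory C] [MonoidalCategory C]
    (M : Type u') [Category.{v'} M] [Preadditive M] [Linear ℂ M] [StarCategory M]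
    [MonoidalLeftAction C M] : Prop extends FinSemisimpleCStarCategory M where
  add_actionHomLeft {c c' : C} (f g : c ⟶ c') (m : M) : (f + g) ⊵ₗ m = f ⊵ₗ m + g ⊵ₗ m
  smul_actionHomLeft {c c' : C} (z : ℂ) (f : c ⟶ c') (m : M) : (z • f) ⊵ₗ m = z • (f ⊵ₗ m)
  actionHomRight_add (c : C) {m m' : M} (f g : m ⟶ m') : c ⊴ₗ (f + g) = c ⊴ₗ f + c ⊴ₗ g
  actionHomRight_smul (c : C) {m m' : M} (z : ℂ) (f : m ⟶ m') : c ⊴ₗ (z • f) = z • (c ⊴ₗ f)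
  dag_actionHom {c c' : C} {m m' : M} (f : c ⟶ c') (g : m ⟶ m') :
    dag (f ⊙ₗₘ g) = dag f ⊙ₗₘ dag g
  actionAssocIso_unitary (c c' : C) (m : M) : IsUnitary (αₗ c c' m).hom

section ModuleFunctors

variable (C : Type u₁) [Category.{v₁} C] [MonoidalCategory C]
variable {M : Type u₂} [Category.{v₂} M] [MonoidalLeftAction C M]
variable {N : Type u₃} [Category.{v₃} N] [MonoidalLeftAction C N]

/-- Natural isomorphisms of module functors: natural isomorphisms `η : F ≅ G` which intertwine the
coherence isomorphisms `F (c ⊙ₗ m) ⟶ c ⊙ₗ F m` and `G (c ⊙ₗ m) ⟶ c ⊙ₗ G m`. -/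
def IsModuleNatIso {F G : M ⥤ N} [F.LeftLinear C] [G.LeftLinear C] (η : F ≅ G) : Prop :=
  ∀ (c : C) (m : M), η.hom.app (c ⊙ₗ m) ≫ δₗ G c m = δₗ F c m ≫ c ⊴ₗ η.hom.app m

/-- Unitary module equivalences: module functors whose underlying functor is an equivalence and
moreover a `*`-equivalence, and whose coherence isomorphism is unitary. -/
structure IsUnitaryModuleEquivalence [Preadditive M] [Linear ℂ M] [StarCategory M]
    [Preadditive N] [Linear ℂ N] [StarCategory N] (G : M ⥤ N) [G.LeftLinear C] : Prop where
  isEquivalence : G.IsEquivalence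
  isStarEquivalence : IsStarEquivalence G
  coherence_unitary (c : C) (m : M) : IsUnitary (δₗ G c m)

end ModuleFunctors

end UnitaryModule

open UnitaryModule

/-! Regard an endomorphism `H` of `F m` as a form, pairing `e` and `e'` from a simple object to `e ≫
H ≫ dag e'`. It suffices to find positive definite forms `H m` on all `F m` for which `F (g^*)` is
adjoint to `F g` and the coherence maps `F (c ⊙ₗ m) ⟶ c ⊙ₗ F m` are isometric
(`exists_invariant_form`). Gram–Schmidt gives `H m = w ≫ dag w` with `w` invertible
(`IsPosDef.exists_factorization`). Conjugating `F` by these `w` turns the forms into identities: the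
new functor is a `*`-functor with unitary coherence, and `w` is the module isomorphism.

The forms arise by averaging, as in Weyl's unitarian trick for finite groups. Semisimplicity of `M`
gives forms `K` with the adjointness property alone (`exists_isPosDef_isAdjointing`). Pull `K` back
along the coherence of `F`, take the partial trace over each simple object `c s` of `C`, and sum
with weights `r s`, the squared norm of the evaluation of `c s`. The weights compensate for
rescaling the evaluations, so no normalized or spherical duality is needed.

Invariance under `x` in `C` is `sum_coevaluation_rotation`: the simple summands of `x ⊗ c t` and
those of `d s ⊗ x`, with `d` the duals, both give bases of `x ⟶ c s ⊗ d t`, and by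
`partialTrace_balance` the weights are exactly what matches the two changes of basis. -/

namespace UnitaryModule

open StarCategory

/-! ### Simple objects and scalars. -/

section Linear

variable {C : Type u} [Category.{v} C] [Preadditive C] [Linear ℂ C]

theorem IsSimpleObject.exists_smul_id {X : C} (hX : IsSimpleObject X) (f : X ⟶ X) :
    ∃ z : ℂ, f = z • 𝟙 X := by
  obtain ⟨e⟩ := hX
  refine ⟨e (End.of f), ?_⟩
  have h := e.symm.commutes (e (End.of f))
  have h2 : e.symm (algebraMap ℂ ℂ (e (End.of f))) = End.of f := e.symm_apply_apply _
  rw [h2, Algebra.algebraMap_eq_smul_one] at h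
  exact h

theorem IsSimpleObject.id_ne_zero {X : C} (hX : IsSimpleObject X) : 𝟙 X ≠ 0 := by
  obtain ⟨e⟩ := hX
  intro h
  have h1 : e (1 : End X) = 1 := map_one e
  have h2 : (1 : End X) = 0 := h
  rw [h2, map_zero] at h1
  exact zero_ne_one h1

theorem IsSimpleObject.smul_id_injective {X : C} (hX : IsSimpleObject X) {z w : ℂ}
    (h : z • 𝟙 X = w • 𝟙 X) : z = w := by
  by_contra hne
  have h0 : (z - w) • 𝟙 X = 0 := by rw [sub_smul, h, sub_self]
  exact hX.id_ne_zero ((smul_eq_zero_iff_right (sub_ne_zero.2 hne)).1 h0)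

/-- An object all of whose endomorphisms are scalar is simple, unless it is zero. -/
theorem isSimpleObject_of_forall {X : C} (h1 : 𝟙 X ≠ 0) (h : ∀ f : X ⟶ X, ∃ z : ℂ, f = z • 𝟙 X) :
    IsSimpleObject X := by
  refine ⟨(AlgEquiv.ofBijective (Algebra.ofId ℂ (End X)) ⟨?_, ?_⟩).symm⟩
  · intro z w hzw
    by_contra hne
    have h0 : (z - w) • 𝟙 X = 0 := by
      have : z • 𝟙 X = w • 𝟙 X := by
        simpa [Algebra.ofId_apply, Algebra.algebraMap_eq_smul_one] using hzw
      rw [sub_smul, this, sub_self]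
    exact h1 ((smul_eq_zero_iff_right (sub_ne_zero.2 hne)).1 h0)
  · intro f
    obtain ⟨z, hz⟩ := h f
    refine ⟨z, ?_⟩
    rw [Algebra.ofId_apply, Algebra.algebraMap_eq_smul_one]
    exact hz.symm

theorem IsSimpleObject.of_iso {X Y : C} (hX : IsSimpleObject X) (i : X ≅ Y) :
    IsSimpleObject Y := by
  refine isSimpleObject_of_forall (fun h => hX.id_ne_zero ?_) fun f => ?_
  · rw [← i.hom_inv_id, ← Category.id_comp i.inv, h, zero_comp, comp_zero]
  · obtain ⟨z, hz⟩ := hX.exists_smul_id (i.hom ≫ f ≫ i.inv)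
    refine ⟨z, ?_⟩
    have h : i.inv ≫ (i.hom ≫ f ≫ i.inv) ≫ i.hom = f := by simp
    rw [← h, hz]
    simp

/-- Simplicity only says that the endomorphism space is a line, so multiplicativity of `e` is not
needed. This matters for duality, which reverses composition. -/
theorem isSimpleObject_of_linearEquiv {X Y : C} (e : (Y ⟶ Y) ≃ₗ[ℂ] (X ⟶ X))
    (hX : IsSimpleObject X) : IsSimpleObject Y := by
  obtain ⟨w, hw⟩ := hX.exists_smul_id (e (𝟙 Y))
  have h0 : ∀ f : Y ⟶ Y, ∃ z : ℂ, f = z • e.symm (𝟙 X) := fun f => by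
    obtain ⟨z, hz⟩ := hX.exists_smul_id (e f)
    exact ⟨z, by rw [← map_smul, ← hz, e.symm_apply_apply]⟩
  have h1 : 𝟙 Y ≠ 0 := by
    intro h
    have h2 : e.symm (𝟙 X) = 0 := by rw [← Category.id_comp (e.symm (𝟙 X)), h, zero_comp]
    exact hX.id_ne_zero (e.symm.map_eq_zero_iff.1 h2)
  obtain ⟨y, hy⟩ := h0 (𝟙 Y)
  have hy0 : y ≠ 0 := by
    rintro rfl
    exact h1 (by rw [hy, zero_smul])
  refine isSimpleObject_of_forall h1 fun f => ?_
  obtain ⟨z, hz⟩ := h0 f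
  exact ⟨z * y⁻¹, by rw [hz, hy, smul_smul, mul_assoc, inv_mul_cancel₀ hy0, mul_one]⟩

end Linear

section Star

variable {C : Type u} [Category.{v} C] [Preadditive C] [Linear ℂ C] [StarCategory C]

/-- The adjoint as an additive map on morphism spaces. -/
def dagHom (X Y : C) : (X ⟶ Y) →+ (Y ⟶ X) :=
  AddMonoidHom.mk' dag dag_add

@[simp] theorem dag_zero (X Y : C) : dag (0 : X ⟶ Y) = 0 := (dagHom X Y).map_zero

theorem dag_sum {X Y : C} {ι : Type*} (s : Finset ι) (f : ι → (X ⟶ Y)) :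
    dag (∑ i ∈ s, f i) = ∑ i ∈ s, dag (f i) := map_sum (dagHom X Y) f s

theorem dag_smul_real {X Y : C} (r : ℝ) (f : X ⟶ Y) : dag ((r : ℂ) • f) = (r : ℂ) • dag f := by
  rw [dag_smul, Complex.conj_ofReal]

theorem isUnitary_of_isIso {X Y : C} (w : X ⟶ Y) [IsIso w] (h : w ≫ dag w = 𝟙 X) :
    IsUnitary w := by
  refine ⟨h, ?_⟩
  rw [← IsIso.inv_eq_of_hom_inv_id h, IsIso.inv_hom_id]

theorem IsUnitary.dag_hom {X Y : C} {w : X ≅ Y} (h : IsUnitary w.hom) : dag w.hom = w.inv := by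
  rw [← Category.id_comp (dag w.hom), ← w.inv_hom_id, Category.assoc, h.1, Category.comp_id]

theorem IsUnitary.dag_inv {X Y : C} {w : X ≅ Y} (h : IsUnitary w.hom) : dag w.inv = w.hom := by
  rw [← h.dag_hom, dag_dag]

end Star

/-! ### Positive definite forms and Gram–Schmidt in a C*-category. -/

section CStar

variable {C : Type u} [Category.{v} C] [Preadditive C] [Linear ℂ C] [StarCategory C]
  [CStarCategory C]

theorem cstarNorm_zero (X Y : C) : cstarNorm (0 : X ⟶ Y) = 0 := by
  have := CStarCategory.norm_smul (0 : ℂ) (0 : X ⟶ Y)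
  simpa using this

theorem eq_zero_of_comp_dag {X Y : C} {f : X ⟶ Y} (h : f ≫ dag f = 0) : f = 0 := by
  apply CStarCategory.eq_zero_of_norm
  have h2 := CStarCategory.norm_comp_dag f
  rw [h, cstarNorm_zero] at h2
  exact pow_eq_zero_iff (two_ne_zero) |>.1 h2.symm

/-- The source of all positivity: the axiom `f^* f = g^* g` has a scalar `g` here, so the value is
some `|z|^2`. The C*-identity gives definiteness. -/
theorem IsSimpleObject.exists_comp_dag {X Y : C} (hX : IsSimpleObject X) (f : X ⟶ Y) :
    ∃ r : ℝ, 0 ≤ r ∧ f ≫ dag f = (r : ℂ) • 𝟙 X ∧ (r = 0 → f = 0) := by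
  obtain ⟨g, hg⟩ := CStarCategory.exists_endo f
  obtain ⟨z, rfl⟩ := hX.exists_smul_id g
  have h : f ≫ dag f = ((Complex.normSq z : ℝ) : ℂ) • 𝟙 X := by
    rw [hg, dag_smul, dag_id, Linear.smul_comp, Category.id_comp, smul_smul, Complex.mul_conj]
  refine ⟨_, Complex.normSq_nonneg z, h, fun h0 => eq_zero_of_comp_dag ?_⟩
  rw [h, h0, Complex.ofReal_zero, zero_smul]

/-- Schur's lemma. -/
theorem isIso_of_ne_zero {X Y : C} (hX : IsSimpleObject X) (hY : IsSimpleObject Y) {f : X ⟶ Y}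
    (hf : f ≠ 0) : IsIso f := by
  obtain ⟨r, -, hr, hr0⟩ := hX.exists_comp_dag f
  obtain ⟨s, -, hs, hs0⟩ := hY.exists_comp_dag (dag f)
  rw [dag_dag] at hs
  have hr' : (r : ℂ) ≠ 0 := by exact_mod_cast fun h => hf (hr0 h)
  have hs' : (s : ℂ) ≠ 0 := by
    exact_mod_cast fun h => hf (by rw [← dag_dag f, hs0 h, dag_zero])
  have h1 : IsSplitMono f := ⟨⟨(r : ℂ)⁻¹ • dag f, by
    rw [Linear.comp_smul, hr, smul_smul, inv_mul_cancel₀ hr', one_smul]⟩⟩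
  have h2 : IsSplitEpi f := ⟨⟨(s : ℂ)⁻¹ • dag f, by
    rw [Linear.smul_comp, hs, smul_smul, inv_mul_cancel₀ hs', one_smul]⟩⟩
  exact isIso_of_mono_of_isSplitEpi f

/-- Positive definite endomorphisms: self-adjoint endomorphisms which are strictly positive on all
morphisms from simple objects. -/
structure IsPosDef {X : C} (H : X ⟶ X) : Prop where
  dag_eq : dag H = H
  pos {S : C} (hS : IsSimpleObject S) (e : S ⟶ X) :
    ∃ r : ℝ, 0 ≤ r ∧ e ≫ H ≫ dag e = (r : ℂ) • 𝟙 S ∧ (r = 0 → e = 0)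

theorem isPosDef_id (X : C) : IsPosDef (𝟙 X) where
  dag_eq := dag_id X
  pos hS e := by simpa using hS.exists_comp_dag e

/-- A sum of squares is definite as soon as the `g i` are jointly faithful on maps from simple
objects. -/
theorem isPosDef_sum {X : C} {ι : Type*} [Fintype ι] {Y : ι → C} (g : ∀ i, X ⟶ Y i)
    (hg : ∀ {S : C}, IsSimpleObject S → ∀ e : S ⟶ X, (∀ i, e ≫ g i = 0) → e = 0) :
    IsPosDef (∑ i, g i ≫ dag (g i)) where
  dag_eq := by simp [dag_sum, dag_comp, dag_dag]
  pos hS e := by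
    choose r hr h1 h2 using fun i => hS.exists_comp_dag (e ≫ g i)
    refine ⟨∑ i, r i, Finset.sum_nonneg fun i _ => hr i, ?_, fun h0 => ?_⟩
    · rw [Complex.ofReal_sum, Finset.sum_smul, Preadditive.sum_comp, Preadditive.comp_sum]
      exact Finset.sum_congr rfl fun i _ => by rw [← h1 i, dag_comp]; simp only [Category.assoc]
    · refine hg hS e fun i => h2 i ?_
      exact (Finset.sum_eq_zero_iff_of_nonneg fun i _ => hr i).1 h0 i (Finset.mem_univ i)

variable {X : C} {n : ℕ} {s : Fin n → C} (hs : ∀ k, IsSimpleObject (s k))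
  (e : ∀ k, s k ⟶ X) (p : ∀ k, X ⟶ s k) (hep : ∀ k, e k ≫ p k = 𝟙 (s k))
  (hep' : ∀ k l, k ≠ l → e k ≫ p l = 0)

-- Induction step of Gram–Schmidt: the first `m` vectors are treated, the others are set to `0` so
-- that all sums run over `Fin n`. The last clause, triangularity against `p`, is what makes the
-- next residual vector nonzero.
omit [CStarCategory C] in
include hs hep hep' in
theorem IsPosDef.exists_partial_orthonormalization {H : X ⟶ X} (hH : IsPosDef H) (m : ℕ)
    (hm : m ≤ n) :
    ∃ θ : ∀ k, s k ⟶ X, (∀ k, k.1 < m → θ k ≫ H ≫ dag (θ k) = 𝟙 (s k)) ∧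
      (∀ k, m ≤ k.1 → θ k = 0) ∧ (∀ k l, k ≠ l → θ k ≫ H ≫ dag (θ l) = 0) ∧
      (∀ k, k.1 < m → e k = ∑ l, e k ≫ H ≫ dag (θ l) ≫ θ l) ∧
      ∀ k l, m ≤ l.1 → θ k ≫ p l = 0 := by
  induction m with
  | zero => exact ⟨fun k => 0, by simp⟩
  | succ m ih =>
    obtain ⟨θ, h1, h2, h3, h4, h5⟩ := ih (Nat.le_of_succ_le hm)
    let a : Fin n := ⟨m, hm⟩
    -- The component of `e a` orthogonal to the earlier vectors; its normalization by the square
    -- root of its length becomes the new vector.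
    let w : s a ⟶ X := e a - ∑ l, e a ≫ H ≫ dag (θ l) ≫ θ l
    have hwp : ∀ l : Fin n, m ≤ l.1 → w ≫ p l = e a ≫ p l := by
      intro l hl
      simp only [w, Preadditive.sub_comp, Preadditive.sum_comp, Category.assoc, h5 _ l hl,
        comp_zero, Finset.sum_const_zero, sub_zero]
    have hwH : ∀ l, w ≫ H ≫ dag (θ l) = 0 := by
      intro l
      simp only [w, Preadditive.sub_comp, Preadditive.sum_comp, Category.assoc]
      rw [Finset.sum_eq_single l (fun k _ hk => by rw [h3 k l hk]; simp) (by simp)]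
      by_cases hl : l.1 < m
      · rw [h1 l hl, Category.comp_id, sub_self]
      · rw [h2 l (not_lt.1 hl)]; simp
    have hwH' : ∀ l, θ l ≫ H ≫ dag w = 0 := by
      intro l
      have := congrArg dag (hwH l)
      simpa [dag_comp, dag_dag, hH.dag_eq] using this
    have hw0 : w ≠ 0 := by
      intro h0
      have := hwp a le_rfl
      rw [h0, zero_comp, hep a] at this
      exact (hs a).id_ne_zero this.symm
    obtain ⟨r, hr, hwr, hr0⟩ := hH.pos (hs a) w
    have hrpos : 0 < r := lt_of_le_of_ne hr fun h => hw0 (hr0 h.symm)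
    have hqq : ((Real.sqrt r : ℝ) : ℂ) * (Real.sqrt r : ℝ) = r := by
      exact_mod_cast Real.mul_self_sqrt hr
    set q : ℝ := Real.sqrt r
    obtain ⟨θ', hself, hoth⟩ : ∃ θ' : ∀ k, s k ⟶ X, θ' a = (q : ℂ)⁻¹ • w ∧
        ∀ k, k ≠ a → θ' k = θ k :=
      ⟨Function.update θ a ((q : ℂ)⁻¹ • w), Function.update_self _ _ _,
        fun k hk => Function.update_of_ne hk _ _⟩
    have hdag : dag ((q : ℂ)⁻¹ • w) = (q : ℂ)⁻¹ • dag w := by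
      rw [← Complex.ofReal_inv, dag_smul_real]
    have hsum : ∀ k, ∑ l, e k ≫ H ≫ dag (θ' l) ≫ θ' l =
        (r : ℂ)⁻¹ • (e k ≫ H ≫ dag w ≫ w) + ∑ l, e k ≫ H ≫ dag (θ l) ≫ θ l := by
      intro k
      rw [← Finset.add_sum_erase _ _ (Finset.mem_univ a),
        ← Finset.add_sum_erase _ (fun l => e k ≫ H ≫ dag (θ l) ≫ θ l) (Finset.mem_univ a),
        h2 a le_rfl, hself, hdag]
      simp only [Linear.smul_comp, Linear.comp_smul, smul_smul, comp_zero, zero_add]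
      rw [← mul_inv, hqq]
      congr 1
      exact Finset.sum_congr rfl fun l hl => by rw [hoth l (Finset.ne_of_mem_erase hl)]
    refine ⟨θ', ?_, ?_, ?_, ?_, ?_⟩
    · intro k hk
      by_cases hka : k = a
      · subst hka
        rw [hself, hdag]
        simp only [Linear.smul_comp, Linear.comp_smul, smul_smul, hwr]
        rw [← mul_assoc, ← mul_inv, hqq, inv_mul_cancel₀ (by exact_mod_cast hrpos.ne'), one_smul]
      · rw [hoth k hka]
        exact h1 k (lt_of_le_of_ne (Nat.lt_succ_iff.1 hk) fun h => hka (Fin.ext h))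
    · intro k hk
      rw [hoth k (fun h => by subst h; exact absurd hk (by simp [a]))]
      exact h2 k (Nat.le_of_succ_le hk)
    · intro k l hkl
      by_cases hka : k = a
      · subst hka
        rw [hself, hoth l (Ne.symm hkl), Linear.smul_comp, hwH, smul_zero]
      · by_cases hla : l = a
        · subst hla
          rw [hself, hoth k hkl, hdag]
          simp only [Linear.comp_smul, hwH', smul_zero]
        · rw [hoth k hka, hoth l hla, h3 k l hkl]
    · intro k hk
      rw [hsum]
      by_cases hka : k = a
      · subst hka
        have he : e a = w + ∑ l, e a ≫ H ≫ dag (θ l) ≫ θ l := by simp [w]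
        have hew : e a ≫ H ≫ dag w = (r : ℂ) • 𝟙 (s a) := by
          rw [← hwr]
          conv_lhs => rw [he]
          simp only [Preadditive.add_comp, Preadditive.sum_comp, Category.assoc, hwH', comp_zero,
            Finset.sum_const_zero, add_zero]
        have : e a ≫ H ≫ dag w ≫ w = (r : ℂ) • w := by
          rw [← Category.id_comp w, ← Linear.smul_comp, ← hew]; simp
        rw [this, smul_smul, inv_mul_cancel₀ (by exact_mod_cast hrpos.ne'), one_smul]
        exact he
      · have hk' : k.1 < m := lt_of_le_of_ne (Nat.lt_succ_iff.1 hk) fun h => hka (Fin.ext h)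
        have hkw : e k ≫ H ≫ dag w = 0 := by
          rw [h4 k hk']
          simp only [Preadditive.sum_comp, Category.assoc, hwH', comp_zero, Finset.sum_const_zero]
        have : e k ≫ H ≫ dag w ≫ w = 0 := by
          rw [← Category.assoc H, ← Category.assoc, hkw, zero_comp]
        rw [this, smul_zero, zero_add]
        exact h4 k hk'
    · intro k l hl
      by_cases hka : k = a
      · subst hka
        rw [hself, Linear.smul_comp, hwp l (Nat.le_of_succ_le hl), hep' a l, smul_zero]
        intro h
        rw [← h] at hl
        exact absurd hl (by simp [a])
      · rw [hoth k hka]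
        exact h5 k l (Nat.le_of_succ_le hl)

omit [CStarCategory C] in
include hs hep hep' in
/-- Gram–Schmidt orthonormalization of a simple decomposition with respect to a positive definite
endomorphism. -/
theorem IsPosDef.exists_orthonormalization (hpe : ∑ k, p k ≫ e k = 𝟙 X) {H : X ⟶ X}
    (hH : IsPosDef H) :
    ∃ θ : ∀ k, s k ⟶ X, (∀ k, θ k ≫ H ≫ dag (θ k) = 𝟙 (s k)) ∧
      (∀ k l, k ≠ l → θ k ≫ H ≫ dag (θ l) = 0) ∧ ∑ k, H ≫ dag (θ k) ≫ θ k = 𝟙 X := by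
  obtain ⟨θ, h1, -, h3, h4, -⟩ :=
    hH.exists_partial_orthonormalization hs e p hep hep' n le_rfl
  refine ⟨θ, fun k => h1 k k.2, h3, ?_⟩
  rw [← Category.id_comp (∑ k, _), ← hpe, Preadditive.sum_comp]
  refine Finset.sum_congr rfl fun k _ => ?_
  rw [Category.assoc, Preadditive.comp_sum, ← h4 k k.2]

-- Orthonormalize one decomposition twice, as `θ` for `H` and as `ι` for the identity form. The
-- change of basis between them is an isometry from `H` to the identity form, so no functional
-- calculus is needed.
include hs hep hep' in
theorem IsPosDef.exists_factorization_of_decomposition (hpe : ∑ k, p k ≫ e k = 𝟙 X) {H : X ⟶ X}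
    (hH : IsPosDef H) : ∃ w : X ⟶ X, IsIso w ∧ w ≫ dag w = H := by
  obtain ⟨θ, h1, h2, h3⟩ := hH.exists_orthonormalization hs e p hep hep' hpe
  obtain ⟨ι, g1, g2, g3⟩ := (isPosDef_id X).exists_orthonormalization hs e p hep hep' hpe
  simp only [Category.id_comp] at g1 g2 g3
  have key : (∑ k, H ≫ dag (θ k) ≫ ι k) ≫ (∑ k, dag (ι k) ≫ θ k) = 𝟙 X := by
    rw [Preadditive.sum_comp, ← h3]
    refine Finset.sum_congr rfl fun k _ => ?_
    rw [Preadditive.comp_sum, Finset.sum_eq_single k (fun l _ hl => ?_) (by simp)]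
    · simp only [Category.assoc, reassoc_of% (g1 k)]
    · simp only [Category.assoc, reassoc_of% (g2 k l hl.symm), zero_comp, comp_zero]
  refine ⟨∑ k, H ≫ dag (θ k) ≫ ι k, ⟨∑ k, dag (ι k) ≫ θ k, key, ?_⟩, ?_⟩
  · rw [Preadditive.sum_comp, ← g3]
    refine Finset.sum_congr rfl fun k _ => ?_
    rw [Preadditive.comp_sum, Finset.sum_eq_single k (fun l _ hl => ?_) (by simp)]
    · simp only [Category.assoc, reassoc_of% (h1 k)]
    · simp only [Category.assoc, reassoc_of% (h2 k l hl.symm), zero_comp, comp_zero]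
  · have : dag (∑ k, H ≫ dag (θ k) ≫ ι k) = (∑ k, dag (ι k) ≫ θ k) ≫ H := by
      simp only [dag_sum, dag_comp, dag_dag, hH.dag_eq, Preadditive.sum_comp, Category.assoc]
    rw [this, ← Category.assoc, key, Category.id_comp]

end CStar

section FinSemisimple

variable {C : Type u} [Category.{v} C] [Preadditive C] [Linear ℂ C] [StarCategory C]
  [FinSemisimpleCStarCategory C]

theorem exists_simple_decomposition (X : C) : ∃ (n : ℕ) (s : Fin n → C) (e : ∀ k, s k ⟶ X)
    (p : ∀ k, X ⟶ s k), (∀ k, IsSimpleObject (s k)) ∧ (∀ k, e k ≫ p k = 𝟙 (s k)) ∧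
      (∀ k l, k ≠ l → e k ≫ p l = 0) ∧ ∑ k, p k ≫ e k = 𝟙 X := by
  obtain ⟨n, s, hs, ⟨i⟩⟩ := FinSemisimpleCStarCategory.exists_decomposition X
  refine ⟨n, s, fun k => biproduct.ι s k ≫ i.inv, fun k => i.hom ≫ biproduct.π s k, hs, ?_, ?_, ?_⟩
  · intro k; simp
  · intro k l hkl; simp [biproduct.ι_π_ne _ hkl]
  · have : ∑ k, (i.hom ≫ biproduct.π s k) ≫ biproduct.ι s k ≫ i.inv =
        i.hom ≫ (∑ k, biproduct.π s k ≫ biproduct.ι s k) ≫ i.inv := by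
      simp only [Preadditive.sum_comp, Preadditive.comp_sum, Category.assoc]
    rw [this, biproduct.total, Category.id_comp, i.hom_inv_id]

/-- Positive definite endomorphisms are of the form `w^* w` with `w` invertible. -/
theorem IsPosDef.exists_factorization {X : C} {H : X ⟶ X} (hH : IsPosDef H) :
    ∃ w : X ⟶ X, IsIso w ∧ w ≫ dag w = H := by
  obtain ⟨n, s, e, p, hs, h1, h2, h3⟩ := exists_simple_decomposition X
  exact hH.exists_factorization_of_decomposition hs e p h1 h2 h3

/-- Isomorphic objects are unitarily isomorphic. -/
theorem exists_unitary_of_iso {X Y : C} (i : X ≅ Y) : ∃ w : X ≅ Y, IsUnitary w.hom := by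
  have hpos : IsPosDef (i.hom ≫ dag i.hom) := by
    have := isPosDef_sum (ι := Unit) (Y := fun _ => Y) (fun _ => i.hom) (fun _ e he => by
      rw [← Category.comp_id e, ← i.hom_inv_id, reassoc_of% (he ()), zero_comp])
    simpa using this
  obtain ⟨w, hw, hwi⟩ := hpos.exists_factorization
  refine ⟨(asIso w).symm ≪≫ i, isUnitary_of_isIso _ ?_⟩
  simp only [Iso.trans_hom, Iso.symm_hom, asIso_inv, dag_comp, Category.assoc]
  rw [← Category.assoc i.hom, ← hwi, Category.assoc, IsIso.inv_hom_id_assoc, ← dag_comp,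
    IsIso.inv_hom_id, dag_id]

end FinSemisimple

end UnitaryModule
namespace UnitaryModule

open StarCategory

/-! ### Representatives of the simple objects. -/

section SimpleBasis

variable {C : Type u} [Category.{v} C] [Preadditive C] [Linear ℂ C]

/-- A family of representatives of the isomorphism classes of simple objects. -/
structure IsSimpleBasis {S : Type*} (c : S → C) : Prop where
  simple (s : S) : IsSimpleObject (c s)
  eq_zero {s t : S} (hst : s ≠ t) (f : c s ⟶ c t) : f = 0
  exists_iso {X : C} (hX : IsSimpleObject X) : ∃ s, Nonempty (X ≅ c s)

variable [StarCategory C] [FinSemisimpleCStarCategory C]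

theorem exists_isSimpleBasis (C : Type u) [Category.{v} C] [Preadditive C] [Linear ℂ C]
    [StarCategory C] [FinSemisimpleCStarCategory C] :
    ∃ (S : Type) (_ : Fintype S) (c : S → C), IsSimpleBasis c := by
  classical
  obtain ⟨n, s, hs⟩ := FinSemisimpleCStarCategory.exists_finite_simples (C := C)
  let T := {i : Fin n // IsSimpleObject (s i)}
  let R : Setoid T :=
    { r := fun i j => Nonempty (s i.1 ≅ s j.1)
      iseqv := ⟨fun i => ⟨Iso.refl _⟩, fun ⟨f⟩ => ⟨f.symm⟩, fun ⟨f⟩ ⟨g⟩ => ⟨f ≪≫ g⟩⟩ }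
  refine ⟨Quotient R, inferInstance, fun q => s q.out.1, fun q => q.out.2, ?_, ?_⟩
  · intro q q' hqq f
    by_contra hf
    have := isIso_of_ne_zero q.out.2 q'.out.2 hf
    apply hqq
    rw [← q.out_eq, ← q'.out_eq]
    exact Quotient.sound ⟨asIso f⟩
  · intro X hX
    obtain ⟨i, ⟨e⟩⟩ := hs X hX
    let j : T := ⟨i, hX.of_iso e⟩
    obtain ⟨g⟩ : Nonempty (s (Quotient.mk R j).out.1 ≅ s j.1) := Quotient.mk_out (s := R) j
    exact ⟨Quotient.mk R j, ⟨e ≪≫ g.symm⟩⟩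

/-- Every object is an orthogonal direct sum of representatives of the simple objects. -/
theorem IsSimpleBasis.exists_orthonormal_decomposition {S : Type*} [Fintype S] {c : S → C}
    (hc : IsSimpleBasis c) (X : C) :
    ∃ (J : S → Type) (_ : ∀ s, Fintype (J s)) (ι : ∀ s, J s → (c s ⟶ X)),
      ∑ s, ∑ i, dag (ι s i) ≫ ι s i = 𝟙 X := by
  classical
  obtain ⟨n, s, e, p, hs, h1, h2, h3⟩ := exists_simple_decomposition X
  obtain ⟨θ, -, -, hθ⟩ := (isPosDef_id X).exists_orthonormalization hs e p h1 h2 h3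
  choose t ht using fun k => hc.exists_iso (hs k)
  choose w hw using fun k => exists_unitary_of_iso (ht k).some
  let f : ∀ k, c (t k) ⟶ X := fun k => (w k).inv ≫ θ k
  refine ⟨fun s => {k // t k = s}, fun s => inferInstance,
    fun s i => eqToHom (by rw [i.2]) ≫ f i.1, ?_⟩
  rw [← hθ]
  refine (Fintype.sum_sigma' _).symm.trans (Fintype.sum_equiv (Equiv.sigmaFiberEquiv t) _ _ ?_)
  rintro ⟨s, k, rfl⟩
  simp [f, dag_comp, Equiv.sigmaFiberEquiv, (hw k).dag_inv]

omit [FinSemisimpleCStarCategory C] in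
-- By Schur's lemma only the `s`-isotypic part of the completeness relation contributes.
-- Orthogonality of the `ι` is never used.
theorem IsSimpleBasis.eq_sum {S : Type*} [Fintype S] {c : S → C} (hc : IsSimpleBasis c) {X : C}
    {J : S → Type*} [∀ s, Fintype (J s)] {ι : ∀ s, J s → (c s ⟶ X)}
    (hι : ∑ s, ∑ i, dag (ι s i) ≫ ι s i = 𝟙 X) {s : S} (f : X ⟶ c s) :
    f = ∑ i, dag (ι s i) ≫ ι s i ≫ f := by
  conv_lhs => rw [← Category.id_comp f, ← hι, Preadditive.sum_comp]
  rw [Finset.sum_eq_single s (fun t _ ht => ?_) (by simp), Preadditive.sum_comp]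
  · simp only [Category.assoc]
  · simp only [Preadditive.sum_comp, Category.assoc, hc.eq_zero ht (_ ≫ f), comp_zero,
      Finset.sum_const_zero]

end SimpleBasis

/-! ### Duals of simple objects. -/

section Dual

variable {C : Type u} [Category.{v} C] [Preadditive C] [Linear ℂ C] [MonoidalCategory C]
  [MonoidalPreadditive C] [MonoidalLinear ℂ C]

/-- Passing to duals is a linear isomorphism on morphism spaces. -/
noncomputable def dualHomEquiv (X Y X' Y' : C) [ExactPairing X Y] [ExactPairing X' Y'] :
    (Y' ⟶ Y) ≃ₗ[ℂ] (X ⟶ X') where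
  __ := (Iso.homCongr (ρ_ Y').symm (Iso.refl Y)).trans <|
    (tensorLeftHomEquiv (𝟙_ C) X' Y' Y).trans <| (tensorRightHomEquiv (𝟙_ C) X Y X').symm.trans <|
      Iso.homCongr (λ_ X) (Iso.refl X')
  map_add' f g := by simp [tensorLeftHomEquiv, tensorRightHomEquiv]
  map_smul' z f := by simp [tensorLeftHomEquiv, tensorRightHomEquiv]

theorem IsSimpleBasis.dual {S : Type*} {c d : S → C} [∀ s, ExactPairing (c s) (d s)]
    (hleft : ∀ X : C, Nonempty (HasLeftDual X)) (hc : IsSimpleBasis c) : IsSimpleBasis d where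
  simple s := isSimpleObject_of_linearEquiv (dualHomEquiv (c s) (d s) (c s) (d s)) (hc.simple s)
  eq_zero {s t} hst f := (dualHomEquiv (c t) (d t) (c s) (d s)).map_eq_zero_iff.1
    (hc.eq_zero hst.symm _)
  exists_iso {Y} hY := by
    obtain ⟨hd⟩ := hleft Y
    obtain ⟨s, ⟨i⟩⟩ := hc.exists_iso
      (isSimpleObject_of_linearEquiv (dualHomEquiv (ᘁY) Y (ᘁY) Y).symm hY)
    exact ⟨s, ⟨rightDualIso (exactPairingCongrLeft i.symm) inferInstance⟩⟩

end Dual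

/-! ### The rotation identity behind averaging. -/

section Rotation

/-- Both sides are the map `Y ⊗ x ⊗ X' ⟶ 𝟙_ C` obtained from `b` by bending both legs down; the two
evaluations act on disjoint strands and may be exchanged. -/
theorem whiskerRight_comp_evaluation {C : Type u} [Category.{v} C] [MonoidalCategory C]
    {X Y X' Y' x : C} [ExactPairing X Y] [ExactPairing X' Y'] (b : x ⟶ X ⊗ Y') :
    (tensorLeftHomEquiv x X Y Y').symm b ▷ X' ≫ ε_ X' Y' =
      (α_ Y x X').hom ≫ Y ◁ (tensorRightHomEquiv x X' Y' X).symm b ≫ ε_ X Y := by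
  simp only [tensorLeftHomEquiv, tensorRightHomEquiv, Equiv.coe_fn_symm_mk]
  calc
    _ = 𝟙 _ ⊗≫ Y ◁ b ▷ X' ⊗≫ (ε_ X Y ▷ (Y' ⊗ X') ≫ 𝟙_ C ◁ ε_ X' Y') ⊗≫ 𝟙 _ := by monoidal
    _ = 𝟙 _ ⊗≫ Y ◁ b ▷ X' ⊗≫ ((Y ⊗ X) ◁ ε_ X' Y' ≫ ε_ X Y ▷ 𝟙_ C) ⊗≫ 𝟙 _ := by
      rw [whisker_exchange]
    _ = _ := by monoidal

variable {C : Type u} [Category.{v} C] [Preadditive C] [Linear ℂ C] [StarCategory C]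
  [MonoidalCategory C] [StarMonoidalCategory C]

theorem dag_whiskerLeft (X : C) {Y Z : C} (f : Y ⟶ Z) : dag (X ◁ f) = X ◁ dag f := by
  rw [← id_tensorHom, StarMonoidalCategory.dag_tensorHom, dag_id, id_tensorHom]

theorem dag_whiskerRight {Y Z : C} (f : Y ⟶ Z) (X : C) : dag (f ▷ X) = dag f ▷ X := by
  rw [← tensorHom_id, StarMonoidalCategory.dag_tensorHom, dag_id, tensorHom_id]

/-- Bend both legs of `a` and `b` down and compose the adjoint of the first with the second. This
scalar can be evaluated by closing the `X` strand or the `Y'` strand, by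
`whiskerRight_comp_evaluation`. -/
theorem partialTrace_balance {X Y X' Y' x : C} [ExactPairing X Y] [ExactPairing X' Y']
    (h1 : IsSimpleObject (𝟙_ C)) (a b : x ⟶ X ⊗ Y') {z w r r' : ℂ}
    (hz : dag ((tensorRightHomEquiv x X' Y' X).symm a) ≫ (tensorRightHomEquiv x X' Y' X).symm b =
      z • 𝟙 X)
    (hw : dag ((tensorLeftHomEquiv x X Y Y').symm a) ≫ (tensorLeftHomEquiv x X Y Y').symm b =
      w • 𝟙 Y')
    (hr : dag (ε_ X Y) ≫ ε_ X Y = r • 𝟙 (𝟙_ C))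
    (hr' : dag (ε_ X' Y') ≫ ε_ X' Y' = r' • 𝟙 (𝟙_ C)) : z * r = w * r' := by
  apply h1.smul_id_injective
  calc
    (z * r) • 𝟙 (𝟙_ C) = dag (ε_ X Y) ≫ Y ◁ (z • 𝟙 X) ≫ ε_ X Y := by
      simp [mul_smul, hr]
    _ = dag ((α_ Y x X').hom ≫ Y ◁ (tensorRightHomEquiv x X' Y' X).symm a ≫ ε_ X Y) ≫
        ((α_ Y x X').hom ≫ Y ◁ (tensorRightHomEquiv x X' Y' X).symm b ≫ ε_ X Y) := by
      rw [← hz, dag_comp, dag_comp, dag_whiskerLeft]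
      simp only [Category.assoc]
      rw [reassoc_of% (StarMonoidalCategory.associator_unitary Y x X').2,
        MonoidalCategory.whiskerLeft_comp_assoc]
    _ = dag (ε_ X' Y') ≫ (w • 𝟙 Y') ▷ X' ≫ ε_ X' Y' := by
      rw [← whiskerRight_comp_evaluation, ← whiskerRight_comp_evaluation, ← hw, dag_comp,
        dag_whiskerRight]
      simp only [Category.assoc, comp_whiskerRight]
    _ = (w * r') • 𝟙 (𝟙_ C) := by simp [mul_smul, hr']

variable [FinSemisimpleCStarCategory C]

/-- Decomposing `x ⊗ c t` on one side and `d s ⊗ x` on the other reduces both sums to forms on the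
same spaces `x ⟶ c s ⊗ d t`, spanned by the `a t s i` as well as by the `b s t j`. -/
theorem sum_coevaluation_rotation {S : Type*} [Fintype S] {c d : S → C}
    [∀ s, ExactPairing (c s) (d s)] (hc : IsSimpleBasis c) (hd : IsSimpleBasis d)
    (h1 : IsSimpleObject (𝟙_ C)) {r : S → ℂ}
    (hr : ∀ s, dag (ε_ (c s) (d s)) ≫ ε_ (c s) (d s) = r s • 𝟙 (𝟙_ C))
    {V : Type*} [AddCommGroup V] [Module ℂ V] {x : C}
    (Q : ∀ y z : C, (x ⟶ y ⊗ z) →ₗ[ℂ] (x ⟶ y ⊗ z) →ₛₗ[starRingEnd ℂ] V)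
    (hQ₁ : ∀ {y y' z : C} (f : y ⟶ y') (a : x ⟶ y ⊗ z) (b : x ⟶ y' ⊗ z),
      Q y' z (a ≫ f ▷ z) b = Q y z a (b ≫ dag f ▷ z))
    (hQ₂ : ∀ {y z z' : C} (g : z ⟶ z') (a : x ⟶ y ⊗ z) (b : x ⟶ y ⊗ z'),
      Q y z' (a ≫ y ◁ g) b = Q y z a (b ≫ y ◁ dag g)) :
    ∑ t, r t • Q (x ⊗ c t) (d t) (tensorRightHomEquiv x (c t) (d t) _ (𝟙 _))
      (tensorRightHomEquiv x (c t) (d t) _ (𝟙 _)) =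
    ∑ s, r s • Q (c s) (d s ⊗ x) (tensorLeftHomEquiv x (c s) (d s) _ (𝟙 _))
      (tensorLeftHomEquiv x (c s) (d s) _ (𝟙 _)) := by
  classical
  choose I hI ι hι using fun t => hc.exists_orthonormal_decomposition (x ⊗ c t)
  choose J hJ κ hκ using fun s => hd.exists_orthonormal_decomposition (d s ⊗ x)
  let A : ∀ t, x ⟶ (x ⊗ c t) ⊗ d t := fun t => tensorRightHomEquiv x (c t) (d t) _ (𝟙 _)
  let B : ∀ s, x ⟶ c s ⊗ (d s ⊗ x) := fun s => tensorLeftHomEquiv x (c s) (d s) _ (𝟙 _)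
  change ∑ t, r t • Q _ _ (A t) (A t) = ∑ s, r s • Q _ _ (B s) (B s)
  have hA : ∀ (t : S) {y : C} (f : x ⊗ c t ⟶ y),
      A t ≫ f ▷ d t = tensorRightHomEquiv x (c t) (d t) y f := fun t y f => by
    rw [← tensorRightHomEquiv_naturality, Category.id_comp]
  have hB : ∀ (s : S) {y : C} (f : d s ⊗ x ⟶ y),
      B s ≫ c s ◁ f = tensorLeftHomEquiv x (c s) (d s) y f := fun s y f => by
    rw [← tensorLeftHomEquiv_naturality, Category.id_comp]
  let a : ∀ t s, I t s → (x ⟶ c s ⊗ d t) := fun t s i => A t ≫ dag (ι t s i) ▷ d t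
  let b : ∀ s t, J s t → (x ⟶ c s ⊗ d t) := fun s t j => B s ≫ c s ◁ dag (κ s t j)
  have ha : ∀ t s i, (tensorRightHomEquiv x (c t) (d t) (c s)).symm (a t s i) =
      dag (ι t s i) := fun t s i => by simp only [a, hA, Equiv.symm_apply_apply]
  have hb : ∀ s t j, (tensorLeftHomEquiv x (c s) (d s) (d t)).symm (b s t j) =
      dag (κ s t j) := fun s t j => by simp only [b, hB, Equiv.symm_apply_apply]
  have hAA : ∀ t, Q _ _ (A t) (A t) = ∑ s, ∑ i, Q _ _ (a t s i) (a t s i) := by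
    intro t
    have h : A t = ∑ s, ∑ i, a t s i ≫ ι t s i ▷ d t := by
      conv_lhs => rw [← Category.comp_id (A t), ← id_whiskerRight, ← hι t]
      simp only [sum_whiskerRight, Preadditive.comp_sum, comp_whiskerRight, a, Category.assoc]
    conv_lhs => enter [1]; rw [h]
    simp only [map_sum, LinearMap.sum_apply, hQ₁]
    rfl
  have hBB : ∀ s, Q _ _ (B s) (B s) = ∑ t, ∑ j, Q _ _ (b s t j) (b s t j) := by
    intro s
    have h : B s = ∑ t, ∑ j, b s t j ≫ c s ◁ κ s t j := by
      conv_lhs => rw [← Category.comp_id (B s), ← whiskerLeft_id, ← hκ s]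
      simp only [whiskerLeft_sum, Preadditive.comp_sum, MonoidalCategory.whiskerLeft_comp, b,
        Category.assoc]
    conv_lhs => enter [1]; rw [h]
    simp only [map_sum, LinearMap.sum_apply, hQ₂]
    rfl
  choose μ hμ using fun t s (i : I t s) (j : J s t) => (hd.simple t).exists_smul_id
    (κ s t j ≫ (tensorLeftHomEquiv x (c s) (d s) (d t)).symm (a t s i))
  choose ν hν using fun t s (i : I t s) (j : J s t) => (hc.simple s).exists_smul_id
    (ι t s i ≫ (tensorRightHomEquiv x (c t) (d t) (c s)).symm (b s t j))
  have hab : ∀ t s i, a t s i = ∑ j, μ t s i j • b s t j := by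
    intro t s i
    obtain ⟨f, hf⟩ : ∃ f, f = (tensorLeftHomEquiv x (c s) (d s) (d t)).symm (a t s i) := ⟨_, rfl⟩
    have h : f = ∑ j, μ t s i j • dag (κ s t j) := by
      refine (hd.eq_sum (hκ s) f).trans (Finset.sum_congr rfl fun j _ => ?_)
      rw [hf, hμ, Linear.comp_smul, Category.comp_id]
    rw [← Equiv.apply_symm_apply (tensorLeftHomEquiv x (c s) (d s) (d t)) (a t s i), ← hf, ← hB, h]
    simp only [whiskerLeft_sum, Preadditive.comp_sum, MonoidalLinear.whiskerLeft_smul,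
      Linear.comp_smul, b]
  have hba : ∀ t s j, b s t j = ∑ i, ν t s i j • a t s i := by
    intro t s j
    obtain ⟨f, hf⟩ : ∃ f, f = (tensorRightHomEquiv x (c t) (d t) (c s)).symm (b s t j) := ⟨_, rfl⟩
    have h : f = ∑ i, ν t s i j • dag (ι t s i) := by
      refine (hc.eq_sum (hι t) f).trans (Finset.sum_congr rfl fun i _ => ?_)
      rw [hf, hν, Linear.comp_smul, Category.comp_id]
    rw [← Equiv.apply_symm_apply (tensorRightHomEquiv x (c t) (d t) (c s)) (b s t j), ← hf, ← hA, h]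
    simp only [sum_whiskerRight, Preadditive.comp_sum, MonoidalLinear.smul_whiskerRight,
      Linear.comp_smul, a]
  -- The two transition matrices are adjoint up to the weights; this fixes the choice of weights.
  have hμν : ∀ t s i j, ν t s i j * r s = starRingEnd ℂ (μ t s i j) * r t := by
    intro t s i j
    refine partialTrace_balance h1 (a t s i) (b s t j) ?_ ?_ (hr s) (hr t)
    · rw [ha, dag_dag, hν]
    · have := congrArg dag (hμ t s i j)
      rw [dag_comp, dag_smul, dag_id] at this
      rw [hb, this]
  simp only [hAA, hBB, Finset.smul_sum]
  rw [Finset.sum_comm]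
  refine Finset.sum_congr rfl fun s _ => Finset.sum_congr rfl fun t _ => ?_
  -- Expanding the second argument of `Q a a` in the `b`, and the first argument of `Q b b` in the
  -- `a`, gives the same mixed sum.
  have e1 : ∀ i, r t • Q _ _ (a t s i) (a t s i) =
      ∑ j, (ν t s i j * r s) • Q _ _ (a t s i) (b s t j) := by
    intro i
    conv_lhs => enter [2, 2]; rw [hab]
    simp only [map_sum, map_smulₛₗ, Finset.smul_sum, smul_smul, hμν, mul_comm]
  have e2 : ∀ j, r s • Q _ _ (b s t j) (b s t j) =
      ∑ i, (ν t s i j * r s) • Q _ _ (a t s i) (b s t j) := by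
    intro j
    conv_lhs => enter [2, 1]; rw [hba]
    simp only [map_sum, map_smul, LinearMap.sum_apply, LinearMap.smul_apply, Finset.smul_sum,
      smul_smul, mul_comm]
  rw [Finset.sum_congr rfl fun i _ => e1 i, Finset.sum_congr rfl fun j _ => e2 j, Finset.sum_comm]

end Rotation

end UnitaryModule
namespace UnitaryModule

open StarCategory MonoidalLeftAction Functor.OplaxLeftLinear

/-! ### Forms compatible with adjoints. -/

section Intertwiner

variable {M : Type u₂} [Category.{v₂} M] [Preadditive M] [Linear ℂ M] [StarCategory M]
variable {N : Type u₃} [Category.{v₃} N] [Preadditive N] [Linear ℂ N] [StarCategory N]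

/-- A family of endomorphisms `K m` of `F m` (thought of as hermitian forms) for which
`F (g^*)` is adjoint to `F g`. -/
def IsAdjointing (F : M ⥤ N) (K : ∀ m, F.obj m ⟶ F.obj m) : Prop :=
  ∀ {m n : M} (g : m ⟶ n), F.map g ≫ K n = K m ≫ dag (F.map (dag g))

theorem exists_isPosDef_isAdjointing [FinSemisimpleCStarCategory M] [CStarCategory N]
    (F : M ⥤ N) [F.Additive] [F.Linear ℂ] :
    ∃ K : ∀ m, F.obj m ⟶ F.obj m, (∀ m, IsPosDef (K m)) ∧ IsAdjointing F K := by
  obtain ⟨S, _, c, hc⟩ := exists_isSimpleBasis M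
  choose J hJ ι hι using fun m => hc.exists_orthonormal_decomposition m
  -- The form making `F m` the orthogonal sum of the `F (c s)`. In these coordinates `g` is a scalar
  -- matrix `z` and `g^*` its conjugate transpose, and linearity of `F` preserves this.
  refine ⟨fun m => ∑ s, ∑ i, F.map (dag (ι m s i)) ≫ dag (F.map (dag (ι m s i))), fun m => ?_, ?_⟩
  · have := isPosDef_sum (ι := Σ s, J m s) (Y := fun k => F.obj (c k.1))
      (fun k => F.map (dag (ι m k.1 k.2))) (fun {S} _ e he => by
        rw [← Category.comp_id e, ← F.map_id, ← hι m]
        simp only [Functor.map_sum, Functor.map_comp, Preadditive.comp_sum]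
        refine Finset.sum_eq_zero fun s _ => Finset.sum_eq_zero fun i _ => ?_
        rw [reassoc_of% (he ⟨s, i⟩), zero_comp])
    rwa [Fintype.sum_sigma] at this
  · intro m n g
    rw [Preadditive.comp_sum, Preadditive.sum_comp]
    refine Finset.sum_congr rfl fun s _ => ?_
    rw [Preadditive.comp_sum, Preadditive.sum_comp]
    choose z hz using fun i j => (hc.simple s).exists_smul_id (ι m s i ≫ g ≫ dag (ι n s j))
    have h1 : ∀ j, g ≫ dag (ι n s j) = ∑ i, z i j • dag (ι m s i) := fun j => by
      refine (hc.eq_sum (hι m) _).trans (Finset.sum_congr rfl fun i _ => ?_)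
      rw [hz, Linear.comp_smul, Category.comp_id]
    have h2 : ∀ i, dag g ≫ dag (ι m s i) = ∑ j, starRingEnd ℂ (z i j) • dag (ι n s j) :=
      fun i => by
        refine (hc.eq_sum (hι n) _).trans (Finset.sum_congr rfl fun j _ => ?_)
        have := congrArg dag (hz i j)
        simp only [dag_comp, dag_dag, dag_smul, dag_id, Category.assoc] at this
        rw [this, Linear.comp_smul, Category.comp_id]
    have e1 : ∀ j, F.map g ≫ F.map (dag (ι n s j)) ≫ dag (F.map (dag (ι n s j))) =
        ∑ i, z i j • F.map (dag (ι m s i)) ≫ dag (F.map (dag (ι n s j))) := fun j => by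
      rw [← F.map_comp_assoc, h1]
      simp only [Functor.map_sum, Functor.map_smul, Preadditive.sum_comp, Linear.smul_comp]
    have e2 : ∀ i, (F.map (dag (ι m s i)) ≫ dag (F.map (dag (ι m s i)))) ≫ dag (F.map (dag g)) =
        ∑ j, z i j • F.map (dag (ι m s i)) ≫ dag (F.map (dag (ι n s j))) := fun i => by
      rw [Category.assoc, ← dag_comp, ← F.map_comp, h2]
      simp only [Functor.map_sum, Functor.map_smul, dag_sum, dag_smul, Preadditive.comp_sum,
        Linear.comp_smul, Complex.conj_conj]
    rw [Finset.sum_congr rfl fun j _ => e1 j, Finset.sum_congr rfl fun i _ => e2 i,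
      Finset.sum_comm]

end Intertwiner

/-! ### The coevaluation of a dual pair acting on a module category. -/

section Action

variable {C : Type u₁} [Category.{v₁} C] [Preadditive C] [Linear ℂ C] [StarCategory C]
  [MonoidalCategory C]
variable {M : Type u₂} [Category.{v₂} M] [Preadditive M] [Linear ℂ M] [StarCategory M]
  [MonoidalLeftAction C M] [UnitaryModuleCategory C M]

theorem dag_actionHomLeft {c c' : C} (f : c ⟶ c') (m : M) : dag (f ⊵ₗ m) = dag f ⊵ₗ m := by
  rw [← actionHom_id, UnitaryModuleCategory.dag_actionHom, dag_id, actionHom_id]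

theorem dag_actionHomRight (c : C) {m m' : M} (g : m ⟶ m') : dag (c ⊴ₗ g) = c ⊴ₗ dag g := by
  rw [← id_actionHom, UnitaryModuleCategory.dag_actionHom, dag_id, id_actionHom]

variable (C) in
theorem actionHomRight_sum (c : C) {m m' : M} {ι : Type*} (s : Finset ι) (g : ι → (m ⟶ m')) :
    c ⊴ₗ (∑ i ∈ s, g i) = ∑ i ∈ s, c ⊴ₗ g i :=
  map_sum (AddMonoidHom.mk' (fun g : m ⟶ m' => c ⊴ₗ g)
    (UnitaryModuleCategory.actionHomRight_add c)) g s

/-- The unit of the adjunction between the actions of an object and of its dual. -/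
def actionCoevaluation (c d : C) [ExactPairing c d] (m : M) : m ⟶ c ⊙ₗ d ⊙ₗ m :=
  (λₗ m).inv ≫ η_ c d ⊵ₗ m ≫ (αₗ c d m).hom

omit [Preadditive C] [Linear ℂ C] [StarCategory C] [Preadditive M] [Linear ℂ M] [StarCategory M]
  [UnitaryModuleCategory C M] in
theorem actionCoevaluation_naturality (c d : C) [ExactPairing c d] {m n : M} (g : m ⟶ n) :
    g ≫ actionCoevaluation c d n = actionCoevaluation c d m ≫ c ⊴ₗ d ⊴ₗ g := by
  simp only [actionCoevaluation, Category.assoc]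
  rw [← actionUnitIso_inv_naturality_assoc, action_exchange_assoc, tensor_actionHomRight]
  simp

-- Together with `actionCoevaluation_action`, this rewrites a coevaluation placed after or before
-- the action of `x` as a morphism of `C` out of `x` acting on `m`, the input of the rotation
-- identity.
omit [Preadditive C] [Linear ℂ C] [StarCategory C] [Preadditive M] [Linear ℂ M] [StarCategory M]
  [UnitaryModuleCategory C M] in
theorem actionHomRight_actionCoevaluation (x c d : C) [ExactPairing c d] (m : M) :
    (tensorRightHomEquiv x c d _ (𝟙 _)) ⊵ₗ m ≫ (αₗ (x ⊗ c) d m).hom ≫ (αₗ x c (d ⊙ₗ m)).hom =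
      x ⊴ₗ actionCoevaluation c d m := by
  have h : (ρ_ x).inv ⊵ₗ m ≫ (αₗ x (𝟙_ C) m).hom = x ⊴ₗ (λₗ m).inv := by
    rw [← cancel_mono (x ⊴ₗ (λₗ m).hom), Category.assoc, ← rightUnitor_actionHom,
      inv_hom_actionHomLeft, actionHomRight_inv_hom]
  simp only [tensorRightHomEquiv, Equiv.coe_fn_mk, id_whiskerRight, Category.comp_id,
    comp_actionHomLeft, Category.assoc, actionCoevaluation, actionHomRight_comp]
  rw [← associator_actionHom, inv_hom_actionHomLeft_assoc, whiskerLeft_actionHomLeft, ← h]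
  simp

omit [Preadditive C] [Linear ℂ C] [StarCategory C] [Preadditive M] [Linear ℂ M] [StarCategory M]
  [UnitaryModuleCategory C M] in
theorem actionCoevaluation_action (x c d : C) [ExactPairing c d] (m : M) :
    (tensorLeftHomEquiv x c d _ (𝟙 _)) ⊵ₗ m ≫ (αₗ c (d ⊗ x) m).hom ≫ c ⊴ₗ (αₗ d x m).hom =
      actionCoevaluation c d (x ⊙ₗ m) := by
  have h : (λ_ x).inv ⊵ₗ m ≫ (αₗ (𝟙_ C) x m).hom = (λₗ (x ⊙ₗ m)).inv := by
    rw [← cancel_mono (λₗ (x ⊙ₗ m)).hom, Category.assoc, ← leftUnitor_actionHom,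
      inv_hom_actionHomLeft, Iso.inv_hom_id]
  simp only [tensorLeftHomEquiv, Equiv.coe_fn_mk, MonoidalCategory.whiskerLeft_id,
    Category.comp_id, comp_actionHomLeft, Category.assoc, actionCoevaluation]
  rw [associator_actionHom, whiskerRight_actionHomLeft, ← h]
  simp

end Action

/-! ### Pulling back and tracing forms along a module functor. -/

section ModuleFunctor

variable {C : Type u₁} [Category.{v₁} C] [Preadditive C] [Linear ℂ C] [StarCategory C]
  [MonoidalCategory C]
variable {M : Type u₂} [Category.{v₂} M] [Preadditive M] [Linear ℂ M] [StarCategory M]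
  [MonoidalLeftAction C M] [UnitaryModuleCategory C M]
variable {N : Type u₃} [Category.{v₃} N] [Preadditive N] [Linear ℂ N] [StarCategory N]
  [MonoidalLeftAction C N] [UnitaryModuleCategory C N]

variable (C) in
/-- Module functors between linear module categories are automatically compatible with scalars. -/
theorem linear_of_leftLinear (F : M ⥤ N) [F.LeftLinear C] [F.Additive] : F.Linear ℂ where
  map_smul {m n} f z := by
    have key : ∀ m : M, F.map (z • 𝟙 m) = z • 𝟙 (F.obj m) := by
      intro m
      -- Scalars on `m` come from scalars on the monoidal unit, whose action `F` respects.
      have h1 : z • 𝟙 m = (λₗ m).inv ≫ (z • 𝟙 (𝟙_ C)) ⊵ₗ m ≫ (λₗ m).hom := by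
        rw [UnitaryModuleCategory.smul_actionHomLeft]
        simp
      have h2 : F.map ((z • 𝟙 (𝟙_ C)) ⊵ₗ m) = z • 𝟙 _ := by
        rw [← cancel_mono (δₗ F (𝟙_ C) m), δₗ_naturality_left,
          UnitaryModuleCategory.smul_actionHomLeft]
        simp
      rw [h1, F.map_comp, F.map_comp, h2]
      simp [← F.map_comp]
    have h : z • f = f ≫ (z • 𝟙 n) := by simp
    rw [h, F.map_comp, key]
    simp

/-- The pullback of `c ⊴ₗ K m` along the coherence isomorphism of `F`. -/
def coherencePullback (F : M ⥤ N) [F.LeftLinear C] (K : ∀ m, F.obj m ⟶ F.obj m) (c : C) (m : M) :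
    F.obj (c ⊙ₗ m) ⟶ F.obj (c ⊙ₗ m) :=
  δₗ F c m ≫ c ⊴ₗ K m ≫ dag (δₗ F c m)

variable {F : M ⥤ N} [F.LeftLinear C] {K : ∀ m, F.obj m ⟶ F.obj m}

omit [Preadditive M] [Linear ℂ M] [StarCategory M] [UnitaryModuleCategory C M] in
theorem map_comp_coherencePullback {c c' : C} (f : c ⟶ c') (m : M) :
    F.map (f ⊵ₗ m) ≫ coherencePullback F K c' m =
      coherencePullback F K c m ≫ dag (F.map (dag f ⊵ₗ m)) := by
  rw [coherencePullback, coherencePullback, δₗ_naturality_left_assoc, ← action_exchange_assoc]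
  simp only [Category.assoc]
  rw [← dag_comp, δₗ_naturality_left, dag_comp, dag_actionHomLeft, dag_dag]

omit [UnitaryModuleCategory C M] in
theorem IsAdjointing.map_comp_coherencePullback (hK : IsAdjointing F K) (c : C) {m n : M}
    (g : m ⟶ n) :
    F.map (c ⊴ₗ g) ≫ coherencePullback F K c n =
      coherencePullback F K c m ≫ dag (F.map (c ⊴ₗ dag g)) := by
  rw [coherencePullback, coherencePullback, δₗ_naturality_right_assoc, ← actionHomRight_comp_assoc,
    hK, actionHomRight_comp]
  simp only [Category.assoc]
  rw [← dag_comp, δₗ_naturality_right, dag_comp, dag_actionHomRight]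

/-- The partial trace over `c` of `coherencePullback F K c`. -/
def partialTraceForm (F : M ⥤ N) [F.LeftLinear C] (K : ∀ m, F.obj m ⟶ F.obj m) (c d : C)
    [ExactPairing c d] (m : M) : F.obj m ⟶ F.obj m :=
  F.map (actionCoevaluation c d m) ≫ coherencePullback F K c (d ⊙ₗ m) ≫
    dag (F.map (actionCoevaluation c d m))

theorem IsAdjointing.partialTraceForm (hK : IsAdjointing F K) (c d : C) [ExactPairing c d] :
    IsAdjointing F (partialTraceForm F K c d) := by
  intro m n g
  rw [UnitaryModule.partialTraceForm, ← F.map_comp_assoc, actionCoevaluation_naturality,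
    F.map_comp_assoc, reassoc_of% (hK.map_comp_coherencePullback c (d ⊴ₗ g)), dag_actionHomRight,
    ← dag_comp, ← F.map_comp, ← actionCoevaluation_naturality, F.map_comp, dag_comp,
    UnitaryModule.partialTraceForm]
  simp only [Category.assoc]

variable (F K) in
/-- The sesquilinear form on `x ⟶ y ⊗ z` given by pulling back `coherencePullback F K y`. -/
noncomputable def pullbackForm [F.Additive] [F.Linear ℂ] (m : M) (x y z : C) :
    (x ⟶ y ⊗ z) →ₗ[ℂ] (x ⟶ y ⊗ z) →ₛₗ[starRingEnd ℂ] (F.obj (x ⊙ₗ m) ⟶ F.obj (x ⊙ₗ m)) :=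
  LinearMap.mk₂'ₛₗ (RingHom.id ℂ) (starRingEnd ℂ)
    (fun a b => F.map (a ⊵ₗ m ≫ (αₗ y z m).hom) ≫ coherencePullback F K y (z ⊙ₗ m) ≫
      dag (F.map (b ⊵ₗ m ≫ (αₗ y z m).hom)))
    (fun a a' b => by
      simp only [UnitaryModuleCategory.add_actionHomLeft, Preadditive.add_comp, F.map_add])
    (fun t a b => by
      simp only [UnitaryModuleCategory.smul_actionHomLeft, Linear.smul_comp, F.map_smul,
        RingHom.id_apply])
    (fun a b b' => by
      simp only [UnitaryModuleCategory.add_actionHomLeft, Preadditive.add_comp,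
        Preadditive.comp_add, F.map_add, dag_add])
    (fun t a b => by
      simp only [UnitaryModuleCategory.smul_actionHomLeft, Linear.smul_comp, Linear.comp_smul,
        F.map_smul, dag_smul])

omit [UnitaryModuleCategory C N] in
theorem pullbackForm_apply [F.Additive] [F.Linear ℂ] (m : M) {x y z : C} (a b : x ⟶ y ⊗ z) :
    pullbackForm F K m x y z a b = F.map (a ⊵ₗ m ≫ (αₗ y z m).hom) ≫
      coherencePullback F K y (z ⊙ₗ m) ≫ dag (F.map (b ⊵ₗ m ≫ (αₗ y z m).hom)) := rfl

theorem pullbackForm_comp_whiskerRight [F.Additive] [F.Linear ℂ] (m : M) {x y y' z : C}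
    (f : y ⟶ y') (a : x ⟶ y ⊗ z) (b : x ⟶ y' ⊗ z) :
    pullbackForm F K m x y' z (a ≫ f ▷ z) b = pullbackForm F K m x y z a (b ≫ dag f ▷ z) := by
  have h : ∀ {y y' : C} (f : y ⟶ y') (a : x ⟶ y ⊗ z), F.map ((a ≫ f ▷ z) ⊵ₗ m ≫ (αₗ y' z m).hom) =
      F.map (a ⊵ₗ m ≫ (αₗ y z m).hom) ≫ F.map (f ⊵ₗ (z ⊙ₗ m)) := fun f a => by
    rw [← F.map_comp, comp_actionHomLeft, whiskerRight_actionHomLeft]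
    simp only [Category.assoc, Iso.inv_hom_id, Category.comp_id]
  rw [pullbackForm_apply, pullbackForm_apply, h, h, dag_comp, Category.assoc,
    reassoc_of% (map_comp_coherencePullback (K := K) f (z ⊙ₗ m))]

theorem IsAdjointing.pullbackForm_comp_whiskerLeft [F.Additive] [F.Linear ℂ]
    (hK : IsAdjointing F K) (m : M) {x y z z' : C}
    (g : z ⟶ z') (a : x ⟶ y ⊗ z) (b : x ⟶ y ⊗ z') :
    pullbackForm F K m x y z' (a ≫ y ◁ g) b = pullbackForm F K m x y z a (b ≫ y ◁ dag g) := by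
  have h : ∀ {z z' : C} (g : z ⟶ z') (a : x ⟶ y ⊗ z), F.map ((a ≫ y ◁ g) ⊵ₗ m ≫ (αₗ y z' m).hom) =
      F.map (a ⊵ₗ m ≫ (αₗ y z m).hom) ≫ F.map (y ⊴ₗ g ⊵ₗ m) := fun g a => by
    rw [← F.map_comp, comp_actionHomLeft, whiskerLeft_actionHomLeft]
    simp only [Category.assoc, Iso.inv_hom_id, Category.comp_id]
  rw [pullbackForm_apply, pullbackForm_apply, h, h, dag_comp, Category.assoc,
    reassoc_of% (hK.map_comp_coherencePullback y (g ⊵ₗ m)), dag_actionHomLeft]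

/-- Associativity of the coherence merges the `x` and `c` strands into `x ⊗ c`; unitarity of the
associator in `N` lets it cancel against its adjoint. -/
theorem coherencePullback_partialTraceForm [F.Additive] [F.Linear ℂ] (x c d : C)
    [ExactPairing c d] (m : M) :
    coherencePullback F (partialTraceForm F K c d) x m =
      pullbackForm F K m x (x ⊗ c) d (tensorRightHomEquiv x c d _ (𝟙 _))
        (tensorRightHomEquiv x c d _ (𝟙 _)) := by
  let R := F.map (tensorRightHomEquiv x c d _ (𝟙 _) ⊵ₗ m ≫ (αₗ (x ⊗ c) d m).hom) ≫
    δₗ F (x ⊗ c) (d ⊙ₗ m)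
  have hR : δₗ F x m ≫ x ⊴ₗ F.map (actionCoevaluation c d m) ≫ x ⊴ₗ δₗ F c (d ⊙ₗ m) =
      R ≫ (αₗ x c (F.obj (d ⊙ₗ m))).hom := by
    simp only [R, Category.assoc, δₗ_associativity]
    rw [← δₗ_naturality_right_assoc, ← actionHomRight_actionCoevaluation]
    simp only [F.map_comp, Category.assoc]
  have hR' : dag (x ⊴ₗ δₗ F c (d ⊙ₗ m)) ≫ dag (x ⊴ₗ F.map (actionCoevaluation c d m)) ≫
      dag (δₗ F x m) = dag ((αₗ x c (F.obj (d ⊙ₗ m))).hom) ≫ dag R := by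
    have := congrArg dag hR
    simpa only [dag_comp, Category.assoc] using this
  have hα := UnitaryModuleCategory.actionAssocIso_unitary x c (F.obj (d ⊙ₗ m))
  calc
    _ = (δₗ F x m ≫ x ⊴ₗ F.map (actionCoevaluation c d m) ≫ x ⊴ₗ δₗ F c (d ⊙ₗ m)) ≫
        x ⊴ₗ c ⊴ₗ K (d ⊙ₗ m) ≫ dag (x ⊴ₗ δₗ F c (d ⊙ₗ m)) ≫
          dag (x ⊴ₗ F.map (actionCoevaluation c d m)) ≫ dag (δₗ F x m) := by
      simp only [coherencePullback, partialTraceForm, actionHomRight_comp, dag_actionHomRight,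
        Category.assoc]
    _ = R ≫ (x ⊗ c) ⊴ₗ K (d ⊙ₗ m) ≫ dag R := by
      rw [hR, hR', tensor_actionHomRight, hα.dag_hom]
      simp only [Category.assoc]
    _ = _ := by
      simp only [R, pullbackForm_apply, coherencePullback, dag_comp, Category.assoc]

/-- Here `x` joins the dual strand `d`. Adjointness of `K` and unitarity of the associator in `M`
remove the associator. -/
theorem IsAdjointing.partialTraceForm_action [F.Additive] [F.Linear ℂ] (hK : IsAdjointing F K)
    (x c d : C) [ExactPairing c d] (m : M) :
    UnitaryModule.partialTraceForm F K c d (x ⊙ₗ m) =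
      pullbackForm F K m x c (d ⊗ x) (tensorLeftHomEquiv x c d _ (𝟙 _))
        (tensorLeftHomEquiv x c d _ (𝟙 _)) := by
  have hα := UnitaryModuleCategory.actionAssocIso_unitary d x m
  rw [UnitaryModule.partialTraceForm, ← actionCoevaluation_action, pullbackForm_apply,
    ← Category.assoc _ _ (c ⊴ₗ (αₗ d x m).hom), F.map_comp, dag_comp, Category.assoc,
    reassoc_of% (hK.map_comp_coherencePullback c (αₗ d x m).hom), hα.dag_hom,
    ← Category.assoc (dag (F.map (c ⊴ₗ (αₗ d x m).inv))), ← dag_comp, ← F.map_comp,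
    actionHomRight_hom_inv, F.map_id, dag_id, Category.id_comp]

end ModuleFunctor

end UnitaryModule
namespace UnitaryModule

open StarCategory MonoidalLeftAction Functor.OplaxLeftLinear Functor.LaxLeftLinear

/-! ### The averaged, invariant form. -/

section InvariantForm

variable {C : Type u₁} [Category.{v₁} C] [Preadditive C] [Linear ℂ C] [StarCategory C]
  [MonoidalCategory C]
variable {M : Type u₂} [Category.{v₂} M] [Preadditive M] [Linear ℂ M] [StarCategory M]
  [MonoidalLeftAction C M]
variable {N : Type u₃} [Category.{v₃} N] [Preadditive N] [Linear ℂ N] [StarCategory N]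
  [MonoidalLeftAction C N]

omit [StarCategory C] in
theorem coevaluation_ne_zero [MonoidalPreadditive C] {X Y : C} [ExactPairing X Y]
    (hX : IsSimpleObject X) : η_ X Y ≠ 0 := by
  intro h
  have := ExactPairing.evaluation_coevaluation X Y
  rw [h, MonoidalPreadditive.zero_whiskerRight, zero_comp] at this
  apply hX.id_ne_zero
  rw [← (λ_ X).inv_hom_id, ← Category.comp_id (λ_ X).hom, ← (ρ_ X).inv_hom_id,
    reassoc_of% this.symm, zero_comp, comp_zero]

omit [StarCategory C] in
theorem evaluation_ne_zero [MonoidalPreadditive C] {X Y : C} [ExactPairing X Y]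
    (hX : IsSimpleObject X) : ε_ X Y ≠ 0 := by
  intro h
  have := ExactPairing.evaluation_coevaluation X Y
  rw [h, MonoidalPreadditive.whiskerLeft_zero, comp_zero, comp_zero] at this
  apply hX.id_ne_zero
  rw [← (λ_ X).inv_hom_id, ← Category.comp_id (λ_ X).hom, ← (ρ_ X).inv_hom_id,
    reassoc_of% this.symm, zero_comp, comp_zero]

variable [UnitaryFusionCategory C] [UnitaryModuleCategory C M] [UnitaryModuleCategory C N]

/-- There is a family of positive definite hermitian forms on the objects `F m` which makes `F`
compatible with adjoints and the coherence isomorphism of `F` isometric. -/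
theorem exists_invariant_form (F : M ⥤ N) [F.LeftLinear C] [F.Additive] [F.Linear ℂ] :
    ∃ H : ∀ m, F.obj m ⟶ F.obj m, (∀ m, IsPosDef (H m)) ∧ IsAdjointing F H ∧
      ∀ (c : C) (m : M), coherencePullback F H c m = H (c ⊙ₗ m) := by
  obtain ⟨K, hKpos, hK⟩ := exists_isPosDef_isAdjointing F
  choose w hw hwK using fun m => (hKpos m).exists_factorization
  obtain ⟨S, _, c, hc⟩ := exists_isSimpleBasis C
  have h1 : IsSimpleObject (𝟙_ C) := UnitaryFusionCategory.unit_simple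
  have hdual : ∀ s, HasRightDual (c s) := fun s =>
    (UnitaryFusionCategory.exists_rightDual (c s)).some
  let d : S → C := fun s => (c s)ᘁ
  have hd : IsSimpleBasis d := hc.dual UnitaryFusionCategory.exists_leftDual
  choose r hr0 hr hr1 using fun s => h1.exists_comp_dag (dag (ε_ (c s) (d s)))
  have hrpos : ∀ s, 0 < r s := fun s => lt_of_le_of_ne (hr0 s) fun h => by
    have h2 := congrArg dag (hr1 s h.symm)
    rw [dag_dag, dag_zero] at h2
    exact evaluation_ne_zero (hc.simple s) h2
  refine ⟨fun m => ∑ s, (r s : ℂ) • partialTraceForm F K (c s) (d s) m, fun m => ?_, ?_, ?_⟩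
  · let g : ∀ s, F.obj m ⟶ c s ⊙ₗ F.obj (d s ⊙ₗ m) := fun s =>
      ((Real.sqrt (r s) : ℝ) : ℂ) • (F.map (actionCoevaluation (c s) (d s) m) ≫
        δₗ F (c s) (d s ⊙ₗ m) ≫ c s ⊴ₗ w (d s ⊙ₗ m))
    have hg : ∀ s, (r s : ℂ) • partialTraceForm F K (c s) (d s) m = g s ≫ dag (g s) := fun s => by
      have : ((Real.sqrt (r s) : ℝ) : ℂ) * (Real.sqrt (r s) : ℝ) = r s := by
        exact_mod_cast Real.mul_self_sqrt (hr0 s)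
      simp only [g, dag_smul_real, Linear.smul_comp, Linear.comp_smul, smul_smul, this]
      simp only [partialTraceForm, coherencePullback, dag_comp, ← hwK, actionHomRight_comp,
        dag_actionHomRight, Category.assoc]
    simp only [hg]
    refine isPosDef_sum g fun {X} _ e he => ?_
    -- Any single index suffices for definiteness; the simple unit shows that one exists. The
    -- coherence and `w` are invertible, and the coevaluation has a retraction up to a nonzero
    -- scalar.
    obtain ⟨s, -⟩ := hc.exists_iso h1
    have he1 : e ≫ F.map (actionCoevaluation (c s) (d s) m) = 0 := by
      have hq : ((Real.sqrt (r s) : ℝ) : ℂ) ≠ 0 := by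
        exact_mod_cast (Real.sqrt_pos.2 (hrpos s)).ne'
      have h2 := he s
      simp only [g, Linear.comp_smul] at h2
      rw [smul_eq_zero_iff_right hq] at h2
      rw [← cancel_mono (δₗ F (c s) (d s ⊙ₗ m) ≫ c s ⊴ₗ w (d s ⊙ₗ m)), zero_comp, Category.assoc,
        h2]
    obtain ⟨z, -, hz, hz0⟩ := h1.exists_comp_dag (η_ (c s) (d s))
    have hz' : (z : ℂ) ≠ 0 := by
      exact_mod_cast fun h => coevaluation_ne_zero (hc.simple s) (hz0 h)
    have hW : actionCoevaluation (c s) (d s) m ≫ (αₗ (c s) (d s) m).inv ≫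
        dag (η_ (c s) (d s)) ⊵ₗ m ≫ (λₗ m).hom = (z : ℂ) • 𝟙 m := by
      simp only [actionCoevaluation, Category.assoc, Iso.hom_inv_id_assoc]
      rw [← comp_actionHomLeft_assoc, hz, UnitaryModuleCategory.smul_actionHomLeft,
        id_actionHomLeft, Linear.smul_comp, Linear.comp_smul, Category.id_comp, Iso.inv_hom_id]
    have h3 : e ≫ F.map ((z : ℂ) • 𝟙 m) = 0 := by
      rw [← hW, F.map_comp, reassoc_of% he1, zero_comp]
    rw [F.map_smul, F.map_id, Linear.comp_smul, Category.comp_id] at h3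
    exact (smul_eq_zero_iff_right hz').1 h3
  · intro m n g
    simp only [Preadditive.comp_sum, Preadditive.sum_comp, Linear.comp_smul, Linear.smul_comp]
    exact Finset.sum_congr rfl fun s _ => by rw [hK.partialTraceForm (c s) (d s) g]
  · intro x m
    -- The left side is the pullback of the averaged form along `x`, the right side its value at `x
    -- ⊙ₗ m`.
    have h2 := sum_coevaluation_rotation hc hd h1 (r := fun s => (r s : ℂ))
      (fun s => by simpa only [dag_dag] using hr s) (pullbackForm F K m x)
      (pullbackForm_comp_whiskerRight m) (hK.pullbackForm_comp_whiskerLeft m)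
    simp only [← coherencePullback_partialTraceForm, ← hK.partialTraceForm_action] at h2
    refine Eq.trans ?_ h2
    simp only [coherencePullback, actionHomRight_sum, UnitaryModuleCategory.actionHomRight_smul,
      Preadditive.comp_sum, Preadditive.sum_comp, Linear.comp_smul, Linear.smul_comp]

end InvariantForm

/-! ### From invariant forms to unitary module equivalences. -/

section StarEquivalence

variable {M : Type u₂} [Category.{v₂} M] [Preadditive M] [Linear ℂ M] [StarCategory M]
variable {N : Type u₃} [Category.{v₃} N] [Preadditive N] [Linear ℂ N] [StarCategory N]

theorem IsStarFunctor.isUnitary_of_map {G : M ⥤ N} (hG : IsStarFunctor G) [G.Faithful] {m n : M}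
    {f : m ⟶ n} (hf : IsUnitary (G.map f)) : IsUnitary f :=
  ⟨G.map_injective (by rw [G.map_comp, hG.map_dag, hf.1, G.map_id]),
    G.map_injective (by rw [G.map_comp, hG.map_dag, hf.2, G.map_id])⟩

/-- A `*`-functor between semisimple C*-categories which is an equivalence is a
`*`-equivalence. -/
theorem IsStarFunctor.isStarEquivalence [FinSemisimpleCStarCategory N] {G : M ⥤ N}
    (hG : IsStarFunctor G) [G.IsEquivalence] : IsStarEquivalence G := by
  -- Unitary comparison maps make the quasi-inverse built from them a `*`-functor.
  choose w hw using fun Y => exists_unitary_of_iso (G.objObjPreimageIso Y)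
  let L : N ⥤ M :=
    { obj Y := G.objPreimage Y
      map f := G.preimage ((w _).hom ≫ f ≫ (w _).inv)
      map_id Y := G.map_injective (by simp)
      map_comp f g := G.map_injective (by simp) }
  have hL : ∀ {Y Y' : N} (f : Y ⟶ Y'), G.map (L.map f) = (w Y).hom ≫ f ≫ (w Y').inv :=
    fun f => G.map_preimage _
  refine ⟨hG, L, ⟨fun f g => ?_, fun z f => ?_, fun f => ?_⟩, ⟨?_, ?_⟩⟩
  · apply G.map_injective
    simp only [hG.map_add, hL, Preadditive.comp_add, Preadditive.add_comp]
  · apply G.map_injective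
    simp only [hG.map_smul, hL, Linear.comp_smul, Linear.smul_comp]
  · apply G.map_injective
    simp only [hG.map_dag, hL, dag_comp, (hw _).dag_inv, (hw _).dag_hom, Category.assoc]
  · refine ⟨NatIso.ofComponents (fun X => G.preimageIso (w (G.obj X))) fun f => ?_, fun X => ?_⟩
    · apply G.map_injective
      simp [hL]
    · apply hG.isUnitary_of_map
      simpa using hw (G.obj X)
  · refine ⟨NatIso.ofComponents w fun f => ?_, fun Y => ?_⟩
    · simp [hL]
    · simpa using hw Y

end StarEquivalence

section Transport

variable {C : Type u₁} [Category.{v₁} C] [MonoidalCategory C]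
variable {M : Type u₂} [Category.{v₂} M] [MonoidalLeftAction C M]
variable {N : Type u₃} [Category.{v₃} N] [MonoidalLeftAction C N]

/-- Transport of the structure of a module functor along a natural isomorphism. -/
@[reducible] def leftLinearOfIso {F G : M ⥤ N} [F.LeftLinear C] (η : F ≅ G) : G.LeftLinear C where
  μₗ c m := c ⊴ₗ η.inv.app m ≫ μₗ F c m ≫ η.hom.app (c ⊙ₗ m)
  μₗ_naturality_left {c c'} f m := by
    rw [← action_exchange_assoc, μₗ_naturality_left_assoc, Category.assoc, Category.assoc,
      η.hom.naturality]
  μₗ_naturality_right c {m m'} g := by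
    rw [← actionHomRight_comp_assoc, η.inv.naturality, actionHomRight_comp_assoc,
      μₗ_naturality_right_assoc, Category.assoc, Category.assoc, η.hom.naturality]
  μₗ_associativity c c' m := by
    rw [Category.assoc, Category.assoc, ← η.hom.naturality, μₗ_associativity_assoc,
      tensor_actionHomRight]
    simp only [Category.assoc, Iso.inv_hom_id_assoc, actionHomRight_comp]
    rw [← actionHomRight_comp_assoc c (η.hom.app _), η.hom_inv_id_app, actionHomRight_id,
      Category.id_comp]
  μₗ_unitality m := by
    rw [Category.assoc, Category.assoc, ← η.hom.naturality, ← μₗ_unitality_assoc,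
      ← actionUnitIso_hom_naturality_assoc, η.inv_hom_id_app, Category.comp_id]
  δₗ c m := η.inv.app (c ⊙ₗ m) ≫ δₗ F c m ≫ c ⊴ₗ η.hom.app m
  δₗ_naturality_left {c c'} f m := by
    rw [η.inv.naturality_assoc, δₗ_naturality_left_assoc, ← action_exchange]
    simp only [Category.assoc]
  δₗ_naturality_right c {m m'} g := by
    rw [η.inv.naturality_assoc, δₗ_naturality_right_assoc]
    simp only [Category.assoc, ← actionHomRight_comp, η.hom.naturality]
  δₗ_associativity c c' m := by
    simp only [Category.assoc, Iso.inv_hom_id, Category.comp_id, actionHomRight_comp,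
      tensor_actionHomRight]
    rw [η.inv.naturality_assoc]
    rw [δₗ_associativity_assoc, ← actionHomRight_comp_assoc c (η.hom.app _), η.hom_inv_id_app,
      actionHomRight_id, Category.id_comp]
  δₗ_unitality_inv m := by
    rw [η.inv.naturality_assoc, ← δₗ_unitality_inv_assoc, actionUnitIso_inv_naturality,
      η.inv_hom_id_app_assoc]
  μₗ_comp_δₗ c m := by
    simp [← actionHomRight_comp]
  δₗ_comp_μₗ c m := by
    simp [← actionHomRight_comp_assoc]

end Transport

section Unitarization

variable {C : Type u₁} [Category.{v₁} C] [Preadditive C] [Linear ℂ C] [StarCategory C]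
  [MonoidalCategory C]
variable {M : Type u₂} [Category.{v₂} M] [Preadditive M] [Linear ℂ M] [StarCategory M]
  [MonoidalLeftAction C M]
variable {N : Type u₃} [Category.{v₃} N] [Preadditive N] [Linear ℂ N] [StarCategory N]
  [MonoidalLeftAction C N]

theorem dag_hom_comp_dag_inv {X Y : N} (e : X ≅ Y) : dag e.hom ≫ dag e.inv = 𝟙 Y := by
  rw [← dag_comp, e.inv_hom_id, dag_id]

theorem IsAdjointing.isStarFunctor {F G : M ⥤ N} [F.Additive] [F.Linear ℂ] {η : F ≅ G}
    (h : IsAdjointing F fun m => η.hom.app m ≫ dag (η.hom.app m)) : IsStarFunctor G := by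
  have hmap : ∀ {m n : M} (g : m ⟶ n), G.map g = η.inv.app m ≫ F.map g ≫ η.hom.app n :=
    fun g => by simp
  refine ⟨fun f g => ?_, fun z f => ?_, fun {m n} f => ?_⟩
  · simp only [hmap, F.map_add, Preadditive.comp_add, Preadditive.add_comp]
  · simp only [hmap, F.map_smul, Linear.comp_smul, Linear.smul_comp]
  · have h1 := h (dag f)
    simp only [dag_dag, Category.assoc] at h1
    simp only [hmap, dag_comp, Category.assoc]
    rw [← Category.comp_id (η.hom.app m), ← dag_hom_comp_dag_inv (η.app m)]
    simp only [Iso.app_hom, Iso.app_inv, reassoc_of% h1, Iso.inv_hom_id_app_assoc]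

theorem isUnitaryModuleEquivalence_of_iso [UnitaryModuleCategory C M] [UnitaryModuleCategory C N]
    {F G : M ⥤ N} [F.LeftLinear C] [F.IsEquivalence] [F.Additive] [F.Linear ℂ] (η : F ≅ G)
    (h : IsAdjointing F fun m => η.hom.app m ≫ dag (η.hom.app m))
    (hinv : ∀ (c : C) (m : M), coherencePullback F (fun m => η.hom.app m ≫ dag (η.hom.app m)) c m =
      η.hom.app (c ⊙ₗ m) ≫ dag (η.hom.app (c ⊙ₗ m))) :
    letI := leftLinearOfIso (C := C) η
    IsUnitaryModuleEquivalence C G := by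
  let := leftLinearOfIso (C := C) η
  have hG : G.IsEquivalence := Functor.isEquivalence_of_iso η
  refine ⟨hG, h.isStarFunctor.isStarEquivalence, fun c m => isUnitary_of_isIso _ ?_⟩
  have hδ : δₗ G c m = η.inv.app (c ⊙ₗ m) ≫ δₗ F c m ≫ c ⊴ₗ η.hom.app m := rfl
  have h1 := hinv c m
  simp only [coherencePullback, actionHomRight_comp, Category.assoc] at h1
  have h2 := dag_hom_comp_dag_inv (η.app (c ⊙ₗ m))
  simp only [Iso.app_hom, Iso.app_inv] at h2
  rw [hδ]
  simp only [dag_comp, dag_actionHomRight, Category.assoc]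
  rw [reassoc_of% h1, h2, Iso.inv_hom_id_app_assoc]

end Unitarization

end UnitaryModule

theorem theoremD
    (C : Type u₁) [Category.{v₁} C] [Preadditive C] [Linear ℂ C] [StarCategory C]
    [MonoidalCategory C] [UnitaryFusionCategory C]
    (M : Type u₂) [Category.{v₂} M] [Preadditive M] [Linear ℂ M] [StarCategory M]
    [MonoidalLeftAction C M] [UnitaryModuleCategory C M]
    (N : Type u₃) [Category.{v₃} N] [Preadditive N] [Linear ℂ N] [StarCategory N]
    [MonoidalLeftAction C N] [UnitaryModuleCategory C N]
    (F : M ⥤ N) [F.LeftLinear C] [F.IsEquivalence] :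
    ∃ (G : M ⥤ N) (_ : G.LeftLinear C),
      IsUnitaryModuleEquivalence C G ∧ ∃ η : F ≅ G, IsModuleNatIso C η := by

  have hadd : F.Additive := F.additive_of_preserves_binary_products
  have hlin : F.Linear ℂ := linear_of_leftLinear C F
  obtain ⟨H, hpos, hadj, hinv⟩ := exists_invariant_form (C := C) F
  choose w hw hwH using fun m => (hpos m).exists_factorization
  obtain ⟨G, η, hη⟩ : ∃ (G : M ⥤ N) (η : F ≅ G),
      ∀ m, η.hom.app m ≫ StarCategory.dag (η.hom.app m) = H m :=
    -- `G` has the same objects as `F`, with morphisms conjugated by `w`.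
    ⟨_, F.isoCopyObj F.obj fun m => asIso (w m), hwH⟩
  obtain rfl : (fun m => η.hom.app m ≫ StarCategory.dag (η.hom.app m)) = H := funext hη
  exact ⟨G, leftLinearOfIso η, isUnitaryModuleEquivalence_of_iso η hadj hinv, η,
    fun c m => η.hom_inv_id_app_assoc (c ⊙ₗ m) _⟩
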